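/- **Conventions.** Let $X$ be a metric space, $a,b\in X$ and $\ell>0$. Write $d(x_0,\dots,x_n)=\sum_{i=1}^n d(x_{i-1},x_i)$. Order $X\times\mathbb R$ by $(x,t)\le(x',t')\iff d(x,x')\le t'-t$, and let $\mathrm{Cau}^\ell(X;a,b)$ be the interval between $(a,0)$ and $(b,\ell)$. Let $\mathrm{Cau}^\ell_{\mathrm{ess}}(X;a,b)$ be the set of points $(x,t)\in\mathrm{Cau}^\ell(X;a,b)$ for which there are $x_0,\dots,x_n\in X$ and $0\le k\le n$ with $x=x_k$, $t=d(a,x_0,\dots,x_k)$ and $d(a,x_0,\dots,x_n,b)=\ell$. Let $\Delta P$ denote the order complex of a poset $P$; $\dot\Delta\mathrm{Cau}^\ell_{\mathrm{ess}}(X;a,b)$ is the subcomplex of $\Delta\mathrm{Cau}^\ell_{\mathrm{ess}}(X;a,b)$ of chains $(x_0,t_0)<\dots<(x_n,t_n)$ with $d(x_0,\dots,x_n)<\ell$. Simplicial complexes contain the empty simplex (of dimension $-1$), except for the *void*, which has no simplices; the *empty complex* has only the empty simplex. $C_{-1}$ is $\mathbb Z$, generated by the empty simplex ($0$ for the void),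 $C_*(K,K')=C_*(K)/C_*(K')$, and $H_*(|K|,|K'|)$ is the homology of this complex. Let $K_\ell$ be the complex of finite chains, including the empty one, in $\mathrm{Cau}^\ell_{\mathrm{ess}}(X;a,b)\smallsetminus\{(a,0),(b,\ell)\}$ if $d(a,b)\le\ell$, and the void if $d(a,b)>\ell$. Let $K'_\ell\subseteq K_\ell$ be the subcomplex of chains $(x_0,t_0)<\dots<(x_k,t_k)$, including the empty one, with $d(a,x_0,\dots,x_k,b)<\ell$ if $d(a,b)<\ell$, and the void if $d(a,b)\ge\ell$. Realizations $|\cdot|$ carry the weak (CW) topology, and the suspension of a pair is $\mathrm{Sus}(Y,A)=(\mathrm{Cone}_\alpha(Y),\ \mathrm{Cone}_\alpha(A)\cup Y)$, where $\mathrm{Cone}_\alpha(\text{void})=\text{void}$ and the cone on the (realization of the) empty complex is the point $\alpha$. The quotient $Y/A$ is pointed by the class of $A$, with $Y/\emptyset=Y\sqcup\{*\}$. $MH^\ell_k(X;a,b)$ is the homology of the complex whose $k$-th group is free on the sequences $(x_0,\dots,x_k)$ with $x_0=a$, $x_k=b$, $x_{i-1}\ne x_i$ for all $i$, and $d(x_0,\dots,x_k)=\ell$,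 with boundary $\sum_{i=1}^{k-1}(-1)^i\partial_i$, where $\partial_i$ removes $x_i$ if this leaves the length equal to $\ell$ and is $0$ otherwise. **Theorem.** Suppose $\ell>0$ and $d(a,b)\le\ell$. 1. If $\mathrm{Cau}^\ell_{\mathrm{ess}}(X;a,b)\ne\emptyset$, the pair $(|\Delta\mathrm{Cau}^\ell_{\mathrm{ess}}(X;a,b)|,\ |\dot\Delta\mathrm{Cau}^\ell_{\mathrm{ess}}(X;a,b)|)$ is homotopy equivalent, as a pair of spaces, to the double suspension $\mathrm{Sus}^2(|K_\ell|,|K'_\ell|)$. 2. In every case (also if $\mathrm{Cau}^\ell_{\mathrm{ess}}(X;a,b)=\emptyset$), the quotient $|\Delta\mathrm{Cau}^\ell_{\mathrm{ess}}(X;a,b)|/|\dot\Delta\mathrm{Cau}^\ell_{\mathrm{ess}}(X;a,b)|$ is homotopy equivalent, as a pointed space, to the quotient $Y/A$ of the double suspension $(Y,A)=\mathrm{Sus}^2(|K_\ell|,|K'_\ell|)$. 3. In every case, $MH^\ell_k(X;a,b)\cong H_{k-2}(|K_\ell|,|K'_\ell|)$ for all integers $k\ge 0$. -/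

import Mathlib

universe u

noncomputable section

namespace MagHomotopy

open CategoryTheory

/-! ## Sequences of points and their lengths -/

/-- The length `d(x₀, …, xₙ) = d(x₀, x₁) + ⋯ + d(xₙ₋₁, xₙ)` of a finite sequence of points. -/
def pathLength {X : Type u} [MetricSpace X] : List X → ℝ
  | [] => 0
  | [_] => 0
  | x :: y :: l => dist x y + pathLength (y :: l)

section PathLength

variable {X : Type u} [MetricSpace X]

lemma pathLength_nonneg : ∀ l : List X, 0 ≤ pathLength l
  | [] => le_refl _
  | [_] => le_refl _
  | _ :: y :: l => add_nonneg dist_nonneg (pathLength_nonneg (y :: l))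

lemma pathLength_cons_le (x y : X) (t : List X) :
    pathLength (x :: t) ≤ dist x y + pathLength (y :: t) := by
  cases t with
  | nil => simp [pathLength]
  | cons z t =>
    have := dist_triangle x y z
    simp only [pathLength]
    linarith

lemma pathLength_le_cons (x : X) (t : List X) : pathLength t ≤ pathLength (x :: t) := by
  cases t with
  | nil => simp [pathLength]
  | cons z t => simp only [pathLength]; linarith [dist_nonneg (x := x) (y := z)]

lemma pathLength_cons_sublist {t s : List X} (h : t.Sublist s) :
    ∀ x : X, pathLength (x :: t) ≤ pathLength (x :: s) := by
  induction h with
  | slnil => intro x; exact le_refl _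
  | cons y _ ih =>
    intro x
    exact (pathLength_cons_le x y _).trans (by simpa [pathLength] using ih y)
  | cons_cons y _ ih => intro x; simpa [pathLength] using ih y

lemma pathLength_sublist {t s : List X} (h : t.Sublist s) : pathLength t ≤ pathLength s := by
  induction h with
  | slnil => exact le_refl _
  | cons y _ ih => exact ih.trans (pathLength_le_cons y _)
  | cons_cons y h _ => exact pathLength_cons_sublist h y

lemma pathLength_append (p : List X) (x : X) (r : List X) :
    pathLength (p ++ x :: r) = pathLength (p ++ [x]) + pathLength (x :: r) := by
  induction p with
  | nil => simp [pathLength]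
  | cons y p ih =>
    cases p with
    | nil => simp [pathLength]
    | cons z p =>
      simp only [List.cons_append, pathLength] at ih ⊢
      linarith

end PathLength

/-! ## The boundary operator on sequences -/

/-- The simplicial boundary `∂(v₀, …, vₙ) = ∑ᵢ (-1)ⁱ (v₀, …, v̂ᵢ, …, vₙ)` on the free abelian group
on all finite sequences. In particular `∂(v) = ()`: the empty sequence plays the role of the empty
simplex, and `∂() = 0`. -/
def boundary (V : Type u) : (List V →₀ ℤ) →ₗ[ℤ] (List V →₀ ℤ) :=
  Finsupp.linearCombination ℤ fun l : List V =>
    ∑ i ∈ Finset.range l.length, (-1 : ℤ) ^ i • Finsupp.single (l.eraseIdx i) (1 : ℤ)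

lemma boundary_single {V : Type u} (l : List V) :
    boundary V (Finsupp.single l 1) =
      ∑ i ∈ Finset.range l.length, (-1 : ℤ) ^ i • Finsupp.single (l.eraseIdx i) (1 : ℤ) := by
  simp [boundary]

lemma boundary_cons {V : Type u} (v : V) (c : List V →₀ ℤ) :
    boundary V (Finsupp.lmapDomain ℤ ℤ (List.cons v) c) =
      c - Finsupp.lmapDomain ℤ ℤ (List.cons v) (boundary V c) := by
  induction c using Finsupp.induction_linear with
  | zero => simp
  | add f g hf hg => simp only [map_add, hf, hg]; abel
  | single l r =>
    have h : boundary V (Finsupp.lmapDomain ℤ ℤ (List.cons v) (Finsupp.single l 1)) =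
        Finsupp.single l 1 -
          Finsupp.lmapDomain ℤ ℤ (List.cons v) (boundary V (Finsupp.single l 1)) := by
      rw [Finsupp.lmapDomain_apply, Finsupp.mapDomain_single, boundary_single, boundary_single,
        List.length_cons, Finset.sum_range_succ', map_sum]
      simp only [List.eraseIdx_cons_succ, List.eraseIdx_cons_zero, pow_zero, one_smul, map_smul,
        Finsupp.lmapDomain_apply, Finsupp.mapDomain_single, pow_succ, mul_neg, mul_one, neg_smul,
        Finset.sum_neg_distrib]
      abel
    have hr : Finsupp.single l r = r • Finsupp.single l (1 : ℤ) := by simp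
    rw [hr, map_smul, map_smul, h, map_smul, map_smul, smul_sub]

lemma boundary_boundary {V : Type u} (c : List V →₀ ℤ) : boundary V (boundary V c) = 0 := by
  induction c using Finsupp.induction_linear with
  | zero => simp
  | add f g hf hg => simp only [map_add, hf, hg, add_zero]
  | single l r =>
    have hr : Finsupp.single l r = r • Finsupp.single l (1 : ℤ) := by simp
    rw [hr, map_smul, map_smul]
    suffices h : boundary V (boundary V (Finsupp.single l 1)) = 0 by rw [h, smul_zero]
    induction l with
    | nil => simp [boundary]
    | cons v l ih =>
      have hc : Finsupp.single (v :: l) (1 : ℤ) =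
          Finsupp.lmapDomain ℤ ℤ (List.cons v) (Finsupp.single l 1) := by
        simp [Finsupp.mapDomain_single]
      rw [hc, boundary_cons, map_sub, boundary_cons, ih (by simp)]
      simp

/-! ## Magnitude homology -/

/-- The sequences `(x₀, …, xₖ)` with `x₀ = a`, `xₖ = b`, `xᵢ₋₁ ≠ xᵢ` for all `i`, and length `ℓ`. -/
def IsMagSeq {X : Type u} [MetricSpace X] (a b : X) (ℓ : ℝ) (l : List X) : Prop :=
  l.head? = some a ∧ l.getLast? = some b ∧ l.IsChain (· ≠ ·) ∧ pathLength l = ℓ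

/-- The magnitude chain group `MC_k^ℓ(X; a, b)`, free on the sequences `(x₀, …, xₖ)` above
(it is zero for `k < 0`). -/
def magChains {X : Type u} [MetricSpace X] (a b : X) (ℓ : ℝ) (k : ℤ) :
    Submodule ℤ (List X →₀ ℤ) :=
  Finsupp.supported ℤ ℤ {l : List X | (l.length : ℤ) = k + 1 ∧ IsMagSeq a b ℓ l}

open Classical in
/-- `∂ᵢ(x₀, …, xₖ)`: remove `xᵢ` if this does not change the length `ℓ`, and `0` otherwise. -/
def magFace {X : Type u} [MetricSpace X] (ℓ : ℝ) (i : ℕ) (l : List X) : List X →₀ ℤ :=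
  if pathLength (l.eraseIdx i) = ℓ then Finsupp.single (l.eraseIdx i) 1 else 0

/-- The boundary `∂ = ∑_{i=1}^{k-1} (-1)ⁱ ∂ᵢ` of the magnitude chain complex. -/
def magBoundary (X : Type u) [MetricSpace X] (ℓ : ℝ) : (List X →₀ ℤ) →ₗ[ℤ] (List X →₀ ℤ) :=
  Finsupp.linearCombination ℤ fun l : List X =>
    ∑ i ∈ Finset.Ico 1 (l.length - 1), (-1 : ℤ) ^ i • magFace ℓ i l

section MagBoundary

variable {X : Type u} [MetricSpace X]

lemma eraseIdx_cases (l : List X) (hl : l.IsChain (· ≠ ·)) (i : ℕ) (hi : i < l.length) :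
    pathLength (l.eraseIdx i) < pathLength l ∨ l.eraseIdx i = [] ∨
      (1 ≤ i ∧ i < l.length - 1 ∧ (l.eraseIdx i).head? = l.head? ∧
        (l.eraseIdx i).getLast? = l.getLast? ∧ (l.eraseIdx i).IsChain (· ≠ ·)) := by
  obtain ⟨p, y, q, rfl, rfl⟩ : ∃ p y q, l = p ++ y :: q ∧ p.length = i :=
    ⟨l.take i, l[i], l.drop (i + 1), by simp, by simp; omega⟩
  have he : (p ++ y :: q).eraseIdx p.length = p ++ q := by
    rw [List.eraseIdx_append_of_length_le (le_refl _)]; simp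
  rw [he]
  rcases List.eq_nil_or_concat' p with rfl | ⟨p, x, rfl⟩
  · rcases q with _ | ⟨z, q⟩
    · right; left; rfl
    · left
      have hyz : y ≠ z := by simpa using (List.isChain_cons_cons.1 hl).1
      have := dist_pos.2 hyz
      simp only [List.nil_append, pathLength]
      linarith
  · rcases q with _ | ⟨z, q⟩
    · left
      have hxy : x ≠ y := by
        simp only [List.append_assoc, List.cons_append, List.nil_append] at hl
        exact (List.isChain_append_cons_cons.1 hl).2.1
      have := dist_pos.2 hxy
      have h := pathLength_append p x [y]
      simp only [List.append_assoc, List.cons_append, List.nil_append, List.append_nil] at h ⊢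
      rw [h]
      simp only [pathLength]
      linarith
    · simp only [List.append_assoc, List.cons_append, List.nil_append] at hl ⊢
      have h1 := pathLength_append p x (y :: z :: q)
      have h2 := pathLength_append p x (z :: q)
      simp only [pathLength] at h1 h2
      obtain ⟨hp, hxy, hq⟩ := List.isChain_append_cons_cons.1 hl
      by_cases hxz : x = z
      · left
        subst hxz
        have := dist_pos.2 hxy
        rw [h1, h2, dist_self]
        linarith [dist_nonneg (x := y) (y := x)]
      · right; right
        refine ⟨by simp, by simp, ?_, ?_, ?_⟩
        · cases p <;> simp
        · simp [List.getLast?_append, List.getLast?_cons_cons]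
        · rw [List.isChain_append_cons_cons]
          exact ⟨hp, hxz, (List.isChain_cons_cons.1 hq).2⟩

open Classical in
/-- Projection onto the span of the magnitude sequences. -/
def magProj (a b : X) (ℓ : ℝ) : (List X →₀ ℤ) →ₗ[ℤ] (List X →₀ ℤ) :=
  Finsupp.linearCombination ℤ fun l : List X =>
    if IsMagSeq a b ℓ l then Finsupp.single l 1 else 0

open Classical in
lemma magProj_single (a b : X) (ℓ : ℝ) (l : List X) :
    magProj a b ℓ (Finsupp.single l 1) =
      if IsMagSeq a b ℓ l then Finsupp.single l 1 else 0 := by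
  simp [magProj]

lemma magBoundary_single (ℓ : ℝ) (l : List X) :
    magBoundary X ℓ (Finsupp.single l 1) =
      ∑ i ∈ Finset.Ico 1 (l.length - 1), (-1 : ℤ) ^ i • magFace ℓ i l := by
  simp [magBoundary]

lemma isMagSeq_eraseIdx_iff {a b : X} {ℓ : ℝ} {l : List X} (hl : IsMagSeq a b ℓ l) {i : ℕ}
    (hi : i < l.length) : IsMagSeq a b ℓ (l.eraseIdx i) ↔
      (1 ≤ i ∧ i < l.length - 1 ∧ pathLength (l.eraseIdx i) = ℓ) := by
  obtain ⟨h1, h2, h3, h4⟩ := hl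
  rcases eraseIdx_cases l h3 i hi with h | h | ⟨h, h', h5, h6, h7⟩
  · constructor
    · intro H; have := H.2.2.2; linarith
    · intro H; have := H.2.2; linarith
  · constructor
    · intro H; have := H.1; simp [h] at this
    · intro H
      have := congrArg List.length h
      rw [List.length_eraseIdx_of_lt hi] at this
      simp only [List.length_nil] at this
      omega
  · exact ⟨fun H => ⟨h, h', H.2.2.2⟩, fun H => ⟨h5.trans h1, h6.trans h2, h7, H.2.2⟩⟩

lemma magBoundary_eq {a b : X} {ℓ : ℝ} {l : List X} (hl : IsMagSeq a b ℓ l) :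
    magBoundary X ℓ (Finsupp.single l 1) =
      magProj a b ℓ (boundary X (Finsupp.single l 1)) := by
  classical
  rw [magBoundary_single, boundary_single, map_sum]
  simp only [map_smul, magProj_single]
  refine Finset.sum_subset_zero_on_sdiff ?_ ?_ ?_
  · intro i hi
    simp only [Finset.mem_Ico, Finset.mem_range] at hi ⊢
    omega
  · intro i hi
    simp only [Finset.mem_sdiff, Finset.mem_Ico, Finset.mem_range] at hi
    rw [if_neg, smul_zero]
    rw [isMagSeq_eraseIdx_iff hl hi.1]
    exact fun H => hi.2 ⟨H.1, H.2.1⟩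
  · intro i hi
    rw [Finset.mem_Ico] at hi
    congr 1
    unfold magFace
    refine if_congr ?_ rfl rfl
    rw [isMagSeq_eraseIdx_iff hl (by omega)]
    exact ⟨fun H => ⟨hi.1, hi.2, H⟩, fun H => H.2.2⟩

/-- Faces that vanish in the magnitude chain complex. -/
def IsMagBad (a b : X) (ℓ : ℝ) (l : List X) : Prop :=
  pathLength l < ℓ ∨ (l.IsChain (· ≠ ·) ∧ ¬ (l.head? = some a ∧ l.getLast? = some b))

lemma magProj_boundary_bad {a b : X} {ℓ : ℝ} {l : List X} (hle : pathLength l ≤ ℓ)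
    (hl : IsMagBad a b ℓ l) :
    magProj a b ℓ (boundary X (Finsupp.single l 1)) = 0 := by
  classical
  rw [boundary_single, map_sum]
  refine Finset.sum_eq_zero fun i hi => ?_
  rw [Finset.mem_range] at hi
  rw [map_smul, magProj_single, if_neg, smul_zero]
  intro H
  have hs : pathLength (l.eraseIdx i) ≤ pathLength l := pathLength_sublist (List.eraseIdx_sublist l i)
  have h4 := H.2.2.2
  rcases hl with hl | ⟨hc, hl⟩
  · linarith
  · rcases eraseIdx_cases l hc i hi with h | h | ⟨_, _, h5, h6, _⟩
    · linarith
    · have := H.1; simp [h] at this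
    · exact hl ⟨h5.symm.trans H.1, h6.symm.trans H.2.1⟩

lemma magBoundary_magBoundary_single {a b : X} {ℓ : ℝ} {l : List X} (hl : IsMagSeq a b ℓ l) :
    magBoundary X ℓ (magBoundary X ℓ (Finsupp.single l 1)) = 0 := by
  classical
  have key : magBoundary X ℓ (magProj a b ℓ (boundary X (Finsupp.single l 1))) =
      magProj a b ℓ (boundary X (boundary X (Finsupp.single l 1))) := by
    rw [boundary_single l]
    simp only [map_sum, map_smul]
    refine Finset.sum_congr rfl fun i hi => ?_
    rw [Finset.mem_range] at hi
    congr 1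
    rw [magProj_single]
    split_ifs with h
    · exact magBoundary_eq h
    · rw [map_zero]
      have hs : pathLength (l.eraseIdx i) ≤ ℓ :=
        (pathLength_sublist (List.eraseIdx_sublist l i)).trans hl.2.2.2.le
      refine (magProj_boundary_bad hs ?_).symm
      rcases hs.lt_or_eq with hlt | heq
      · exact Or.inl hlt
      · right
        rcases eraseIdx_cases l hl.2.2.1 i hi with h' | h' | ⟨h1, h2, _⟩
        · linarith [hl.2.2.2]
        · simp [h']
        · exact absurd ((isMagSeq_eraseIdx_iff hl hi).2 ⟨h1, h2, heq⟩) h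
  rw [magBoundary_eq hl, key, boundary_boundary, map_zero]

lemma magBoundary_mem {a b : X} {ℓ : ℝ} {k m : ℤ} (h : m + 1 = k) (c : List X →₀ ℤ)
    (hc : c ∈ magChains a b ℓ k) : magBoundary X ℓ c ∈ magChains a b ℓ m := by
  classical
  have hle : magChains a b ℓ k ≤ (magChains a b ℓ m).comap (magBoundary X ℓ) := by
    unfold magChains
    rw [Finsupp.supported_eq_span_single, Submodule.span_le]
    rintro _ ⟨l, ⟨hlen, hl⟩, rfl⟩
    simp only [SetLike.mem_coe, Submodule.mem_comap]
    rw [magBoundary_single]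
    refine Submodule.sum_mem _ fun i hi => Submodule.smul_mem _ _ ?_
    rw [Finset.mem_Ico] at hi
    unfold magFace
    split_ifs with hp
    · refine Finsupp.single_mem_supported ℤ _ ⟨?_, ?_⟩
      · rw [List.length_eraseIdx_of_lt (by omega)]; omega
      · exact (isMagSeq_eraseIdx_iff hl (by omega)).2 ⟨hi.1, hi.2, hp⟩
    · exact Submodule.zero_mem _
  exact hle hc

lemma magBoundary_magBoundary {a b : X} {ℓ : ℝ} {k : ℤ} (c : List X →₀ ℤ)
    (hc : c ∈ magChains a b ℓ k) : magBoundary X ℓ (magBoundary X ℓ c) = 0 := by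
  have hle : magChains a b ℓ k ≤ LinearMap.ker (magBoundary X ℓ ∘ₗ magBoundary X ℓ) := by
    unfold magChains
    rw [Finsupp.supported_eq_span_single, Submodule.span_le]
    rintro _ ⟨l, ⟨_, hl⟩, rfl⟩
    exact magBoundary_magBoundary_single hl
  exact hle hc

end MagBoundary

/-- The magnitude chain complex `MC_*^ℓ(X; a, b)`, extended by zero in negative degrees. -/
def magComplex {X : Type u} [MetricSpace X] (a b : X) (ℓ : ℝ) :
    ChainComplex (ModuleCat.{u} ℤ) ℤ where
  X k := ModuleCat.of ℤ (magChains a b ℓ k)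
  d k m :=
    if h : m + 1 = k then
      ModuleCat.ofHom ((magBoundary X ℓ).restrict fun c hc => magBoundary_mem h c hc)
    else 0
  shape k m h := dif_neg h
  d_comp_d' k m n hkm hmn := by
    have h1 : m + 1 = k := hkm
    have h2 : n + 1 = m := hmn
    rw [dif_pos h1, dif_pos h2]
    rw [← ModuleCat.ofHom_comp]
    refine ModuleCat.hom_ext (LinearMap.ext fun c => Subtype.ext ?_)
    exact magBoundary_magBoundary c.1 c.2

/-- The magnitude homology group `MH_k^ℓ(X; a, b)`. -/
def magHomology {X : Type u} [MetricSpace X] (a b : X) (ℓ : ℝ) (k : ℤ) : ModuleCat.{u} ℤ :=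
  (magComplex a b ℓ).homology k

/-! ## Simplicial complexes, with the void and the empty complex distinguished -/

/-- A simplicial complex whose simplices are finite chains of a poset `V`, each simplex
`{v₀ < ⋯ < vₙ}` being written as the list `[v₀, …, vₙ]`. The empty list is the simplex of
dimension `-1`; the complex with no simplices at all is the void, and the complex whose only simplex
is the empty one is the empty simplicial complex. -/
structure OrdComplex (V : Type u) [PartialOrder V] where
  faces : Set (List V)
  increasing : ∀ s ∈ faces, s.Pairwise (· < ·)
  down_closed : ∀ s ∈ faces, ∀ t : List V, t.Sublist s → t ∈ faces

/-- The order complex `Δ P` of a subset `P` of a poset (with the empty simplex). -/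
def orderComplex {V : Type u} [PartialOrder V] (P : Set V) : OrdComplex V where
  faces := {s | s.Pairwise (· < ·) ∧ ∀ v ∈ s, v ∈ P}
  increasing _ hs := hs.1
  down_closed _ hs _ ht := ⟨hs.1.sublist ht, fun v hv => hs.2 v (ht.subset hv)⟩

/-- Intersection of two complexes. -/
def OrdComplex.inter {V : Type u} [PartialOrder V] (S T : OrdComplex V) : OrdComplex V where
  faces := S.faces ∩ T.faces
  increasing s hs := S.increasing s hs.1
  down_closed s hs t ht := ⟨S.down_closed s hs.1 t ht, T.down_closed s hs.2 t ht⟩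

/-- `C_n(S)`: free on the `n`-dimensional simplices; `C_{-1}(S)` is generated by the empty simplex,
so it is `0` for the void and `ℤ` for every other complex. -/
def simpChains {V : Type u} [PartialOrder V] (S : OrdComplex V) (n : ℤ) :
    Submodule ℤ (List V →₀ ℤ) :=
  Finsupp.supported ℤ ℤ {s : List V | s ∈ S.faces ∧ (s.length : ℤ) = n + 1}

lemma boundary_mem {V : Type u} [PartialOrder V] (S : OrdComplex V) {k m : ℤ} (h : m + 1 = k)
    (c : List V →₀ ℤ) (hc : c ∈ simpChains S k) : boundary V c ∈ simpChains S m := by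
  have hle : simpChains S k ≤ (simpChains S m).comap (boundary V) := by
    unfold simpChains
    rw [Finsupp.supported_eq_span_single, Submodule.span_le]
    rintro _ ⟨l, ⟨hl, hlen⟩, rfl⟩
    simp only [SetLike.mem_coe, Submodule.mem_comap]
    rw [boundary_single]
    refine Submodule.sum_mem _ fun i hi => Submodule.smul_mem _ _ ?_
    rw [Finset.mem_range] at hi
    refine Finsupp.single_mem_supported ℤ _ ⟨S.down_closed l hl _ (List.eraseIdx_sublist l i), ?_⟩
    rw [List.length_eraseIdx_of_lt hi]; omega
  exact hle hc

/-- The boundary `C_k(S) → C_m(S)`, for `m = k - 1`. -/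
def simpBoundary {V : Type u} [PartialOrder V] (S : OrdComplex V) {k m : ℤ} (h : m + 1 = k) :
    simpChains S k →ₗ[ℤ] simpChains S m :=
  (boundary V).restrict fun c hc => boundary_mem S h c hc

/-- The chain complex `C_*(S, T) = C_*(S) / C_*(T)` of a pair of complexes `T ⊆ S`. -/
def relComplex {V : Type u} [PartialOrder V] (S T : OrdComplex V) :
    ChainComplex (ModuleCat.{u} ℤ) ℤ where
  X n := ModuleCat.of ℤ (simpChains S n ⧸ (simpChains T n).submoduleOf (simpChains S n))
  d k m :=
    if h : m + 1 = k then
      ModuleCat.ofHom (Submodule.mapQ _ _ (simpBoundary S h) fun c hc => boundary_mem T h c.1 hc)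
    else 0
  shape k m h := dif_neg h
  d_comp_d' k m n hkm hmn := by
    have h1 : m + 1 = k := hkm
    have h2 : n + 1 = m := hmn
    rw [dif_pos h1, dif_pos h2]
    rw [← ModuleCat.ofHom_comp]
    refine ModuleCat.hom_ext (LinearMap.ext fun c => ?_)
    obtain ⟨c, rfl⟩ := Submodule.Quotient.mk_surjective _ c
    have hz : simpBoundary S h2 (simpBoundary S h1 c) = 0 :=
      Subtype.ext (boundary_boundary c.1)
    change Submodule.Quotient.mk (simpBoundary S h2 (simpBoundary S h1 c)) = 0
    rw [hz, Submodule.Quotient.mk_zero]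

/-- The homology `H_n(S, T)` of a pair of complexes `T ⊆ S`. -/
def relHomology {V : Type u} [PartialOrder V] (S T : OrdComplex V) (n : ℤ) : ModuleCat.{u} ℤ :=
  (relComplex S T).homology n

/-- The geometric realization `|S|`: barycentric coordinates whose support is a simplex of `S`. -/
def Realization {V : Type u} [PartialOrder V] (S : OrdComplex V) : Type u :=
  {w : V →₀ ℝ // (∀ v, 0 ≤ w v) ∧ (w.sum fun _ r => r) = 1 ∧
    ∃ s ∈ S.faces, ∀ v, w v ≠ 0 ↔ v ∈ s}

/-- The closed cell of `|S|` spanned by a list of vertices. -/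
def Realization.Cell {V : Type u} [PartialOrder V] (S : OrdComplex V) (s : List V) : Type u :=
  {w : Realization S // ∀ v, w.1 v ≠ 0 → v ∈ s}

/-- Each closed cell carries the Euclidean topology given by its barycentric coordinates. -/
instance Realization.Cell.instTopologicalSpace {V : Type u} [PartialOrder V] (S : OrdComplex V)
    (s : List V) : TopologicalSpace (Realization.Cell S s) :=
  TopologicalSpace.induced (fun (w : Realization.Cell S s) (v : V) => w.1.1 v) inferInstance

/-- `|S|` carries the weak (CW) topology: the finest one for which the inclusions of all closed
simplices are continuous. -/
instance Realization.instTopologicalSpace {V : Type u} [PartialOrder V] (S : OrdComplex V) :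
    TopologicalSpace (Realization S) :=
  ⨆ s : S.faces, TopologicalSpace.coinduced
    (fun w : Realization.Cell S s.1 => (w.1 : Realization S)) inferInstance

/-! ## Pairs of spaces, with the void and the empty space distinguished -/

/-- A pair of spaces `A ⊆ X`, where the empty space comes in two versions: the (realization of the)
empty complex and the void. The propositions `spaceNonvoid`, `subNonvoid` say that `X`,
respectively `A`, is not the void. -/
structure SpacePair where
  space : Type u
  [top : TopologicalSpace space]
  sub : Set space
  spaceNonvoid : Prop
  subNonvoid : Prop
  spaceNonvoid_of_mem : space → spaceNonvoid
  subNonvoid_of_mem : ∀ x ∈ sub, subNonvoid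
  spaceNonvoid_of_sub : subNonvoid → spaceNonvoid

attribute [instance] SpacePair.top

/-- The pair `(|S|, |T|)` of realizations of complexes `T ⊆ S`; a complex is not the void iff it
contains the empty simplex. -/
def realizationPair {V : Type u} [PartialOrder V] (S T : OrdComplex V)
    (h : T.faces ⊆ S.faces) : SpacePair.{u} where
  space := Realization S
  sub := {w | ∃ s ∈ T.faces, ∀ v, w.1 v ≠ 0 ↔ v ∈ s}
  spaceNonvoid := [] ∈ S.faces
  subNonvoid := [] ∈ T.faces
  spaceNonvoid_of_mem w := by
    obtain ⟨s, hs, _⟩ := w.2.2.2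
    exact S.down_closed s hs [] (List.nil_sublist s)
  subNonvoid_of_mem := by
    rintro w ⟨s, hs, _⟩
    exact T.down_closed s hs [] (List.nil_sublist s)
  spaceNonvoid_of_sub h0 := h h0

/-- Gluing relation of the cone: all points `(x, 1)` are identified with the apex. -/
inductive ConeRel (Y : Type u) (nonvoid : Prop) :
    (Y × unitInterval) ⊕ {_u : Unit // nonvoid} → (Y × unitInterval) ⊕ {_u : Unit // nonvoid} → Prop
  | glue (y : Y) (h : nonvoid) : ConeRel Y nonvoid (Sum.inl (y, 1)) (Sum.inr ⟨(), h⟩)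

/-- The cone `Cone_α(Y) = {α} * Y`. The cone on the void is the void, and the cone on the empty
space is the apex `{α}`. -/
def Cone (Y : Type u) (nonvoid : Prop) : Type u :=
  Quot (ConeRel Y nonvoid)

instance Cone.instTopologicalSpace (Y : Type u) [TopologicalSpace Y] (nonvoid : Prop) :
    TopologicalSpace (Cone Y nonvoid) :=
  inferInstanceAs (TopologicalSpace (Quot _))

/-- The point at height `t` on the segment from `y` (`t = 0`) to the apex (`t = 1`). -/
def Cone.point {Y : Type u} {nonvoid : Prop} (y : Y) (t : unitInterval) : Cone Y nonvoid :=
  Quot.mk _ (Sum.inl (y, t))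

/-- The apex `α`, which is there unless the base is the void. -/
def Cone.apex {Y : Type u} {nonvoid : Prop} (h : nonvoid) : Cone Y nonvoid :=
  Quot.mk _ (Sum.inr ⟨(), h⟩)

/-- The suspension `Sus(X, A) = (Cone_α(X), Cone_α(A) ∪ X)` of a pair. -/
def SpacePair.sus (P : SpacePair.{u}) : SpacePair.{u} where
  space := Cone P.space P.spaceNonvoid
  sub := {z | (∃ x ∈ P.sub, ∃ t, z = Cone.point x t) ∨
    (P.subNonvoid ∧ ∃ h : P.spaceNonvoid, z = Cone.apex h) ∨ ∃ x, z = Cone.point x 0}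
  spaceNonvoid := P.spaceNonvoid
  subNonvoid := P.subNonvoid ∨ P.spaceNonvoid
  spaceNonvoid_of_mem z := by
    induction z using Quot.ind with
    | mk z =>
      rcases z with ⟨x, _⟩ | ⟨_, h⟩
      · exact P.spaceNonvoid_of_mem x
      · exact h
  subNonvoid_of_mem := by
    rintro _ (⟨x, _, _⟩ | ⟨h, _⟩ | ⟨x, _⟩)
    · exact Or.inr (P.spaceNonvoid_of_mem x)
    · exact Or.inl h
    · exact Or.inr (P.spaceNonvoid_of_mem x)
  spaceNonvoid_of_sub h := h.elim P.spaceNonvoid_of_sub id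

/-- Homotopy equivalence of pairs of spaces `(Y, A) ≃ (Z, B)`: maps of pairs that are mutually
inverse up to homotopies through maps of pairs. -/
def PairHomotopyEquiv {Y Z : Type u} [TopologicalSpace Y] [TopologicalSpace Z]
    (A : Set Y) (B : Set Z) : Prop :=
  ∃ (f : C(Y, Z)) (g : C(Z, Y)), Set.MapsTo f A B ∧ Set.MapsTo g B A ∧
    (g.comp f).HomotopicWith (ContinuousMap.id Y) (fun h => Set.MapsTo h A A) ∧
    (f.comp g).HomotopicWith (ContinuousMap.id Z) (fun h => Set.MapsTo h B B)

/-- Gluing relation of the quotient `Y / A`: all points of `A` are identified with the base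
point. -/
inductive CollapseRel {Y : Type u} (A : Set Y) : Y ⊕ Unit → Y ⊕ Unit → Prop
  | glue (y : Y) (h : y ∈ A) : CollapseRel A (Sum.inl y) (Sum.inr ())

/-- The quotient `Y / A` with its base point; `Y / ∅` is `Y` with a disjoint base point. -/
def Collapse {Y : Type u} (A : Set Y) : Type u :=
  Quot (CollapseRel A)

instance Collapse.instTopologicalSpace {Y : Type u} [TopologicalSpace Y] (A : Set Y) :
    TopologicalSpace (Collapse A) :=
  inferInstanceAs (TopologicalSpace (Quot _))

/-- The base point of `Y / A`. -/
def Collapse.base {Y : Type u} (A : Set Y) : Collapse A :=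
  Quot.mk _ (Sum.inr ())

/-! ## The causal poset and its complexes -/

/-- A point `(x, t)` of the spacetime `X × ℝ`. -/
@[ext]
structure Event (X : Type u) where
  pt : X
  time : ℝ

/-- The causal order: `(x, t) ≤ (x', t')` iff `d(x, x') ≤ t' - t`. -/
instance Event.instPartialOrder {X : Type u} [MetricSpace X] : PartialOrder (Event X) where
  le p q := dist p.pt q.pt ≤ q.time - p.time
  le_refl p := by simp
  le_trans p q r hpq hqr := by
    have := dist_triangle p.pt q.pt r.pt
    linarith
  le_antisymm p q hpq hqp := by
    have h1 : 0 ≤ dist p.pt q.pt := dist_nonneg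
    have h2 : 0 ≤ dist q.pt p.pt := dist_nonneg
    exact Event.ext (dist_le_zero.1 (by linarith)) (by linarith)

section Causal

variable {X : Type u} [MetricSpace X]

/-- The causal interval `Cau^ℓ(X; a, b)` between `(a, 0)` and `(b, ℓ)`. -/
def causal (a b : X) (ℓ : ℝ) : Set (Event X) :=
  Set.Icc ⟨a, 0⟩ ⟨b, ℓ⟩

/-- The essential subposet `Cau_ess^ℓ(X; a, b)`: the points `(x, t)` for which there are points
`x₀, …, xₙ` and `k ≤ n` with `x = xₖ`, `t = d(a, x₀, …, xₖ)` and `d(a, x₀, …, xₙ, b) = ℓ`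
(here `p = (x₀, …, xₖ₋₁)` and `q = (xₖ₊₁, …, xₙ)`). -/
def essential (a b : X) (ℓ : ℝ) : Set (Event X) :=
  {e | e ∈ causal a b ℓ ∧ ∃ p q : List X,
    e.time = pathLength (a :: (p ++ [e.pt])) ∧
    pathLength (a :: (p ++ e.pt :: (q ++ [b]))) = ℓ}

/-- The length `d(x₀, …, xₙ)` of the sequence of points underlying `(x₀, t₀), …, (xₙ, tₙ)`. -/
def eventLength (s : List (Event X)) : ℝ :=
  pathLength (s.map Event.pt)

/-- The subcomplex of `Δ Cau^ℓ(X; a, b)` of causal sequences with `d(x₀, …, xₙ) < ℓ`. -/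
def causalDot (a b : X) (ℓ : ℝ) : OrdComplex (Event X) where
  faces := {s | s ∈ (orderComplex (causal a b ℓ)).faces ∧ eventLength s < ℓ}
  increasing s hs := (orderComplex (causal a b ℓ)).increasing s hs.1
  down_closed s hs t ht :=
    ⟨(orderComplex (causal a b ℓ)).down_closed s hs.1 t ht,
      (pathLength_sublist (ht.map Event.pt)).trans_lt hs.2⟩

/-- The complex `Δ Cau_ess^ℓ(X; a, b)`. -/
def essComplex (a b : X) (ℓ : ℝ) : OrdComplex (Event X) :=
  orderComplex (essential a b ℓ)

/-- The subcomplex `Δ Cau_ess^ℓ(X; a, b) ∩ Δ̇ Cau^ℓ(X; a, b)` of `Δ Cau_ess^ℓ(X; a, b)`. -/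
def essComplexDot (a b : X) (ℓ : ℝ) : OrdComplex (Event X) :=
  (essComplex a b ℓ).inter (causalDot a b ℓ)

/-- The pair `(|Δ Cau_ess^ℓ(X; a, b)|, |Δ̇ Cau_ess^ℓ(X; a, b)|)`. -/
def essPair (a b : X) (ℓ : ℝ) : SpacePair.{u} :=
  realizationPair (essComplex a b ℓ) (essComplexDot a b ℓ) Set.inter_subset_left

/-- The poset `𝒦^ℓ(X; a, b) = Cau_ess^ℓ(X; a, b) ∖ {(a, 0), (b, ℓ)}`. -/
def innerPoset (a b : X) (ℓ : ℝ) : Set (Event X) :=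
  essential a b ℓ \ {⟨a, 0⟩, ⟨b, ℓ⟩}

/-- The complex `K_ℓ(X; a, b)`: the order complex of `𝒦^ℓ(X; a, b)` (with the empty simplex), but
the void if `d(a, b) > ℓ`. -/
def aiComplex (a b : X) (ℓ : ℝ) : OrdComplex (Event X) where
  faces := {s | dist a b ≤ ℓ ∧ s ∈ (orderComplex (innerPoset a b ℓ)).faces}
  increasing s hs := (orderComplex (innerPoset a b ℓ)).increasing s hs.2
  down_closed s hs t ht := ⟨hs.1, (orderComplex (innerPoset a b ℓ)).down_closed s hs.2 t ht⟩

/-- The subcomplex `K'_ℓ(X; a, b)` of sequences with `d(a, x₀, …, xₖ, b) < ℓ` (with the empty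
simplex), but the void if `d(a, b) ≥ ℓ`. -/
def aiComplexDot (a b : X) (ℓ : ℝ) : OrdComplex (Event X) where
  faces := {s | s ∈ (aiComplex a b ℓ).faces ∧ dist a b < ℓ ∧
    pathLength (a :: (s.map Event.pt ++ [b])) < ℓ}
  increasing s hs := (aiComplex a b ℓ).increasing s hs.1
  down_closed s hs t ht :=
    ⟨(aiComplex a b ℓ).down_closed s hs.1 t ht, hs.2.1,
      (pathLength_sublist
        (((ht.map Event.pt).append (List.Sublist.refl [b])).cons_cons a)).trans_lt hs.2.2⟩

/-- The pair `(|K_ℓ(X; a, b)|, |K'_ℓ(X; a, b)|)`. -/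
def aiPair (a b : X) (ℓ : ℝ) : SpacePair.{u} :=
  realizationPair (aiComplex a b ℓ) (aiComplexDot a b ℓ) fun _ hs => hs.1

end Causal

end MagHomotopy

end

/-! Adjoining a least or a greatest element to a poset turns its order complex into a cone. As soon
as one event is essential, so are both endpoints `(a, 0)` and `(b, ℓ)`; the essential poset is then
the inner poset with these two added, and its order complex is a double cone on `K_ℓ`. A causal
chain is no longer than the time it spans (`eventLength_le_sub`), so length `ℓ` forces both
endpoints to occur. Hence every chain missing an endpoint is short, and a chain with both is short
exactly when its inner part lies in `K'_ℓ`. This is precisely the subcomplex of a double suspension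
(`isConePair_bot`, `isConePair_top`), so the pairs are even homeomorphic.

`IsConePair` treats both cones at once: its join `ins` prepends the bottom or appends the top. The
comparison of the topological cone with the realized one (`coneHomeomorph`) is where the weak
topology matters. Joint continuity on `|S| × [0,1]` is obtained by currying, and the inverse is
continuous on each closed cell because that cell is a quotient of a compact space. `mem_sus_sub_iff`
matches the subspaces.

If no event is essential, then `d(a,b) < ℓ`, and `K_ℓ` and `K'_ℓ` are both the empty complex rather
than the void. The subspace of the double suspension is then everything, and both quotients are
points.

For homology, the group `C_n(K_ℓ, K'_ℓ)` is free on the chains with `d(a, x₀, …, xₙ, b) = ℓ`.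
Equality in the time estimate determines the times from the points (`eq_eventsFrom`), so these
chains are the magnitude sequences with their two ends removed. The degree shifts by 2, and the
index shift by 1 makes the differentials agree up to sign. -/

noncomputable section

namespace MagHomotopy

open Topology

/-! ## Closed cells and the weak topology -/

section Cells

variable {V : Type u} [PartialOrder V]

/-- The point `w` lies in the interior of one of the simplices in `T`. -/
def IsCarried (T : Set (List V)) (w : V →₀ ℝ) : Prop :=
  ∃ s ∈ T, ∀ v, w v ≠ 0 ↔ v ∈ s

lemma eq_of_pairwise_lt_of_mem_iff {s t : List V} (hs : s.Pairwise (· < ·))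
    (ht : t.Pairwise (· < ·)) (h : ∀ v, v ∈ s ↔ v ∈ t) : s = t :=
  List.Perm.eq_of_pairwise (fun _ _ _ _ h1 h2 => absurd h2 h1.not_gt) hs ht
    ((List.perm_ext_iff_of_nodup (hs.imp ne_of_lt) (ht.imp ne_of_lt)).2 h)

variable (S : OrdComplex V)

variable {S} in
-- A face is a strictly increasing list, hence determined by the support of any point in its
-- interior; membership in a subcomplex can therefore be tested on that one face.
lemma isCarried_iff_mem {T' : Set (List V)} (hT : T' ⊆ S.faces) {t : List V} (ht : t ∈ S.faces)
    {w : V →₀ ℝ} (hw : ∀ v, w v ≠ 0 ↔ v ∈ t) : IsCarried T' w ↔ t ∈ T' := by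
  refine ⟨fun ⟨s, hs, h⟩ => ?_, fun h => ⟨t, h, hw⟩⟩
  rwa [eq_of_pairwise_lt_of_mem_iff (S.increasing t ht) (S.increasing s (hT hs)) fun v =>
    (hw v).symm.trans (h v)]

lemma OrdComplex.exists_face_of_subset {s : List V} (hs : s ∈ S.faces) {w : V →₀ ℝ}
    (hw : ∀ v, w v ≠ 0 → v ∈ s) : IsCarried S.faces w := by
  classical
  refine ⟨s.filter fun v => w v ≠ 0, S.down_closed s hs _ List.filter_sublist, fun v => ?_⟩
  simp only [List.mem_filter, decide_eq_true_eq]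
  exact ⟨fun h => ⟨hw v h, h⟩, fun h => h.2⟩

lemma Realization.Cell.continuous_coord (s : List V) (v : V) :
    Continuous fun w : Realization.Cell S s => w.1.1 v :=
  (continuous_apply v).comp continuous_induced_dom

variable {S} in
lemma Realization.Cell.continuous_iff {Z : Type*} [TopologicalSpace Z] {s : List V}
    {f : Z → Realization.Cell S s} : Continuous f ↔ ∀ v, Continuous fun z => (f z).1.1 v :=
  continuous_induced_rng.trans continuous_pi_iff

lemma Realization.continuous_cell {s : List V} (hs : s ∈ S.faces) :
    Continuous fun w : Realization.Cell S s => (w.1 : Realization S) :=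
  continuous_iSup_rng (i := (⟨s, hs⟩ : S.faces)) continuous_coinduced_rng

variable {S}

lemma Realization.continuous_iff {Z : Type*} [TopologicalSpace Z] {f : Realization S → Z} :
    Continuous f ↔ ∀ s ∈ S.faces, Continuous fun w : Realization.Cell S s => f w.1 := by
  rw [continuous_iSup_dom]
  simp only [continuous_coinduced_dom, Subtype.forall]
  rfl

/-- A map into a realization is continuous if it takes values in one closed cell and its barycentric
coordinates are continuous. -/
lemma Realization.continuous_of_coord {Z : Type*} [TopologicalSpace Z] {s : List V}
    (hs : s ∈ S.faces) {f : Z → Realization S} (hf : ∀ z v, (f z).1 v ≠ 0 → v ∈ s)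
    (hc : ∀ v, Continuous fun z => (f z).1 v) : Continuous f := by
  let g : Z → Realization.Cell S s := fun z => ⟨f z, hf z⟩
  have hg : Continuous g := Realization.Cell.continuous_iff.2 hc
  exact (Realization.continuous_cell S hs).comp hg

instance Realization.Cell.instT2Space (s : List V) : T2Space (Realization.Cell S s) :=
  T2Space.of_injective_continuous (f := fun (w : Realization.Cell S s) (v : V) => w.1.1 v)
    (fun _ _ h => Subtype.ext (Subtype.ext (DFunLike.coe_injective h))) continuous_induced_dom

/-- In coordinates the cell is a closed subset of the cube `[0,1]^V`. The sum condition is closed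
because it involves only the finitely many vertices of `s`. -/
lemma Realization.Cell.compactSpace {s : List V} (hs : s ∈ S.faces) :
    CompactSpace (Realization.Cell S s) := by
  classical
  have hind : IsInducing fun (w : Realization.Cell S s) (v : V) => w.1.1 v := ⟨rfl⟩
  rw [← isCompact_univ_iff, hind.isCompact_iff, Set.image_univ]
  have hr : Set.range (fun (w : Realization.Cell S s) (v : V) => w.1.1 v) =
      {f | (∀ v, 0 ≤ f v) ∧ (∀ v, v ∉ s → f v = 0) ∧ ∑ v ∈ s.toFinset, f v = 1} := by
    ext f
    constructor
    · rintro ⟨w, rfl⟩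
      refine ⟨w.1.2.1, fun v hv => not_not.1 fun h => hv (w.2 v h), ?_⟩
      refine Eq.trans (Finsupp.sum_of_support_subset w.1.1 (fun v hv => ?_) (fun _ r => r)
        (by simp)).symm w.1.2.2.1
      exact List.mem_toFinset.2 (w.2 v (Finsupp.mem_support_iff.1 hv))
    · rintro ⟨h0, h1, h2⟩
      have hsub : ∀ v, f v ≠ 0 → v ∈ s := fun v hv => not_not.1 fun h => hv (h1 v h)
      let w : V →₀ ℝ := Finsupp.onFinset s.toFinset f fun v hv => List.mem_toFinset.2 (hsub v hv)
      refine ⟨⟨⟨w, h0, ?_, S.exists_face_of_subset hs hsub⟩, hsub⟩, rfl⟩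
      rw [← h2, Finsupp.sum_of_support_subset w (s := s.toFinset)
        Finsupp.support_onFinset_subset _ (by simp)]
      rfl
  rw [hr]
  refine (isCompact_univ_pi fun _ : V => isCompact_Icc (a := (0 : ℝ)) (b := 1)).of_isClosed_subset
    ?_ ?_
  · simp only [Set.ofPred_and, Set.ofPred_forall]
    refine (isClosed_iInter fun v => isClosed_le continuous_const (continuous_apply v)).inter
      ((isClosed_iInter fun v => isClosed_iInter fun _ =>
        isClosed_eq (continuous_apply v) continuous_const).inter
        (isClosed_eq (continuous_finsetSum _ fun v _ => continuous_apply v) continuous_const))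
  · rintro f ⟨h0, h1, h2⟩ v -
    refine ⟨h0 v, ?_⟩
    by_cases hv : v ∈ s
    · rw [← h2]
      exact Finset.single_le_sum (fun i _ => h0 i) (List.mem_toFinset.2 hv)
    · rw [h1 v hv]; exact zero_le_one

end Cells

/-! ## The cone on a realization -/

section Cone

lemma Cone.point_one {Y : Type u} {nv : Prop} (y : Y) (hn : nv) :
    (Cone.point y 1 : Cone Y nv) = Cone.apex hn :=
  Quot.sound (ConeRel.glue y hn)

lemma Cone.eq_apex_or_point {Y : Type u} {nv : Prop} (z : Cone Y nv) :
    (∃ h, z = Cone.apex h) ∨ ∃ y t, z = Cone.point y t := by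
  induction z using Quot.ind with
  | mk z =>
    rcases z with ⟨y, t⟩ | ⟨_, h⟩
    · exact Or.inr ⟨y, t, rfl⟩
    · exact Or.inl ⟨h, rfl⟩

lemma Cone.continuous_point {Y : Type u} [TopologicalSpace Y] {nv : Prop} :
    Continuous fun p : Y × unitInterval => (Cone.point p.1 p.2 : Cone Y nv) :=
  continuous_quot_mk.comp continuous_inl

/-- The summand carrying the apex has at most one point, so it imposes no condition. -/
lemma Cone.continuous_iff {Y : Type u} {Z : Type*} [TopologicalSpace Y] [TopologicalSpace Z] {nv : Prop}
    {f : Cone Y nv → Z} :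
    Continuous f ↔ Continuous fun p : Y × unitInterval => f (Cone.point p.1 p.2) := by
  refine ⟨fun h => h.comp Cone.continuous_point, fun h => continuous_coinduced_dom.2 ?_⟩
  exact continuous_sum_dom.2 ⟨h, continuous_of_const fun ⟨_, _⟩ ⟨_, _⟩ => rfl⟩

end Cone

section JoinPoint

variable {V : Type u}

/-- The point at height `t` between `w` and the vertex `v`. -/
def joinPoint (v : V) (w : V →₀ ℝ) (t : ℝ) : V →₀ ℝ :=
  (1 - t) • w + Finsupp.single v t

lemma joinPoint_self {v : V} {w : V →₀ ℝ} (hw : w v = 0) (t : ℝ) : joinPoint v w t v = t := by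
  simp [joinPoint, hw]

lemma joinPoint_of_ne {v x : V} (hx : x ≠ v) (w : V →₀ ℝ) (t : ℝ) :
    joinPoint v w t x = (1 - t) * w x := by
  simp [joinPoint, hx.symm]

lemma joinPoint_one (v : V) (w : V →₀ ℝ) : joinPoint v w 1 = Finsupp.single v 1 := by
  simp [joinPoint]

lemma joinPoint_zero (v : V) (w : V →₀ ℝ) : joinPoint v w 0 = w := by
  simp [joinPoint]

end JoinPoint

/-! ### Simplicial cones and their realizations. -/

section ConeRealization

variable {V : Type u} [PartialOrder V]

/-- The pair `(T, T')` is the cone with apex `v` on `(S, S')`, together with the base: `ins s` is the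
join of the simplex `s` with `v`. -/
structure IsConePair (S : OrdComplex V) (S' : Set (List V)) (T : OrdComplex V)
    (T' : Set (List V)) (v : V) (ins : List V → List V) : Prop where
  nil_mem : [] ∈ S.faces
  not_mem : ∀ s ∈ S.faces, v ∉ s
  mem_ins : ∀ s x, x ∈ ins s ↔ x = v ∨ x ∈ s
  base_mem : ∀ s ∈ S.faces, s ∈ T.faces
  ins_face : ∀ s ∈ S.faces, ins s ∈ T.faces
  face_of_not_mem : ∀ t ∈ T.faces, v ∉ t → t ∈ S.faces
  face_of_mem : ∀ t ∈ T.faces, v ∈ t → ∃ s ∈ S.faces, t = ins s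
  base_sub_subset : S' ⊆ S.faces
  sub_subset : T' ⊆ T.faces
  sub_of_not_mem : ∀ t ∈ T.faces, v ∉ t → t ∈ T'
  ins_mem_sub : ∀ s ∈ S.faces, ins s ∈ T' ↔ s ∈ S'

variable {S T : OrdComplex V} {S' T' : Set (List V)} {v : V} {ins : List V → List V}

namespace IsConePair

lemma apply_eq_zero (h : IsConePair S S' T T' v ins) (w : Realization S) : w.1 v = 0 := by
  obtain ⟨s, hs, hw⟩ := w.2.2.2
  exact not_not.1 fun h0 => h.not_mem s hs ((hw v).1 h0)

lemma mem_ins_of_joinPoint_ne_zero (h : IsConePair S S' T T' v ins) {w : V →₀ ℝ} {s : List V}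
    (hw : ∀ x, w x ≠ 0 → x ∈ s) {t : ℝ} {x : V} (hx : joinPoint v w t x ≠ 0) : x ∈ ins s := by
  rw [h.mem_ins]
  by_cases hxv : x = v
  · exact Or.inl hxv
  · rw [joinPoint_of_ne hxv] at hx
    exact Or.inr (hw x (right_ne_zero_of_mul hx))

/-- The apex of the cone, as a point of the realization. -/
def apexPoint (h : IsConePair S S' T T' v ins) : Realization T :=
  ⟨Finsupp.single v 1, fun x => by
      classical
      rw [Finsupp.single_apply]; split_ifs <;> norm_num, by simp,
    T.exists_face_of_subset (h.ins_face _ h.nil_mem) fun x hx => (h.mem_ins _ _).2 <| by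
      classical
      rw [Finsupp.single_apply] at hx
      split_ifs at hx with hv
      · exact Or.inl hv.symm
      · exact absurd rfl hx⟩

/-- The point of `|T|` at height `t` over a point of `|S|`. -/
def point (h : IsConePair S S' T T' v ins) (w : Realization S) (t : unitInterval) :
    Realization T :=
  ⟨joinPoint v w.1 t, fun x => by
      classical
      have h1 : 0 ≤ (1 - (t : ℝ)) * w.1 x := mul_nonneg (sub_nonneg.2 t.2.2) (w.2.1 x)
      have h2 : 0 ≤ Finsupp.single v (t : ℝ) x := by
        rw [Finsupp.single_apply]
        split_ifs
        exacts [t.2.1, le_rfl]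
      exact add_nonneg h1 h2,
    by
      rw [joinPoint, Finsupp.sum_add_index' (by simp) (by simp), Finsupp.sum_smul_index' (by simp),
        Finsupp.sum_single_index rfl]
      simp only [smul_eq_mul]
      rw [← Finsupp.mul_sum, w.2.2.1]
      ring,
    by
      obtain ⟨s, hs, hw⟩ := w.2.2.2
      exact T.exists_face_of_subset (h.ins_face s hs) fun x =>
        h.mem_ins_of_joinPoint_ne_zero fun y => (hw y).1⟩

lemma point_one (h : IsConePair S S' T T' v ins) (w : Realization S) :
    h.point w 1 = h.apexPoint :=
  Subtype.ext (joinPoint_one v w.1)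

lemma continuous_point_coord (h : IsConePair S S' T T' v ins) (s : List V) (x : V) :
    Continuous fun p : Realization.Cell S s × unitInterval => (h.point p.1.1 p.2).1 x := by
  have hc := (Realization.Cell.continuous_coord S s x).comp (continuous_fst (Y := unitInterval))
  have ht : Continuous fun p : Realization.Cell S s × unitInterval => (p.2 : ℝ) :=
    continuous_subtype_val.comp continuous_snd
  change Continuous fun p : Realization.Cell S s × unitInterval =>
    (1 - (p.2 : ℝ)) * p.1.1.1 x + Finsupp.single v (p.2 : ℝ) x
  refine ((continuous_const.sub ht).mul hc).add ?_
  by_cases hx : x = v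
  · subst hx
    simpa only [Finsupp.single_eq_same] using ht
  · simpa [hx] using continuous_const

lemma continuous_point_cell (h : IsConePair S S' T T' v ins) {s : List V} (hs : s ∈ S.faces) :
    Continuous fun p : Realization.Cell S s × unitInterval => h.point p.1.1 p.2 := by
  refine Realization.continuous_of_coord (h.ins_face s hs) (fun p x hx => ?_)
    (h.continuous_point_coord s)
  exact h.mem_ins_of_joinPoint_ne_zero p.1.2 hx

lemma continuous_point_right (h : IsConePair S S' T T' v ins) (w : Realization S) :
    Continuous (h.point w) := by
  obtain ⟨s, hs, hw⟩ := w.2.2.2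
  obtain ⟨w', rfl⟩ : ∃ w' : Realization.Cell S s, w'.1 = w := ⟨⟨w, fun x => (hw x).1⟩, rfl⟩
  have := (h.continuous_point_cell hs).comp (Continuous.prodMk_right w')
  exact this

/-- The weak topology only gives control one cell of `|S|` at a time. As a map into the path space
`C([0,1], |T|)`, the cone parametrization has domain `|S|` and can be tested on cells; uncurrying
then gives joint continuity. -/
lemma continuous_point_left (h : IsConePair S S' T T' v ins) :
    Continuous fun w : Realization S =>
      (⟨h.point w, h.continuous_point_right w⟩ : C(unitInterval, Realization T)) := by
  rw [Realization.continuous_iff]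
  intro s hs
  exact (ContinuousMap.curry ⟨_, h.continuous_point_cell hs⟩).continuous

lemma continuous_point (h : IsConePair S S' T T' v ins) :
    Continuous fun p : Realization S × unitInterval => h.point p.1 p.2 :=
  ContinuousMap.continuous_uncurry_of_continuous ⟨_, h.continuous_point_left⟩

/-- The height is the weight at `v`; unless it is 1, the remaining weights are rescaled to sum 1.
The support clause keeps the base point in the closed cell of `S` under the given cell of `T`. -/
lemma exists_point (h : IsConePair S S' T T' v ins) (w : Realization T) :
    w = h.apexPoint ∨ ∃ (y : Realization S) (t : unitInterval), w = h.point y t ∧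
      ∀ x, y.1 x ≠ 0 → w.1 x ≠ 0 ∧ x ≠ v := by
  classical
  obtain ⟨t, ht, hw⟩ := w.2.2.2
  have hsum : w.1 v + (w.1.erase v).sum (fun _ r => r) = 1 := by
    exact (Finsupp.add_sum_erase' _ _ _ (fun _ => rfl)).trans w.2.2.1
  have hnn : 0 ≤ (w.1.erase v).sum fun _ r => r := by
    refine Finset.sum_nonneg fun x _ => ?_
    rw [Finsupp.erase_apply]
    split_ifs
    exacts [le_rfl, w.2.1 x]
  by_cases h1 : w.1 v = 1
  · left
    have h0 : (w.1.erase v).sum (fun _ r => r) = 0 := by linarith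
    refine Subtype.ext (Finsupp.ext fun x => ?_)
    by_cases hx : x = v
    · subst hx; simpa [apexPoint] using h1
    · simp only [apexPoint, Finsupp.single_apply, if_neg (Ne.symm hx)]
      by_contra hne
      have hxs : x ∈ (w.1.erase v).support := by simp [hx, hne]
      have := (Finset.sum_eq_zero_iff_of_nonneg (fun y _ => by
        rw [Finsupp.erase_apply]
        split_ifs
        exacts [le_rfl, w.2.1 y])).1 h0 x hxs
      rw [Finsupp.erase_ne hx] at this
      exact hne this
  · right
    have hlt : 0 < 1 - w.1 v := lt_of_le_of_ne (by linarith) fun h0 => h1 (by linarith)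
    let y : V →₀ ℝ := (1 - w.1 v)⁻¹ • w.1.erase v
    have hyx : ∀ x, x ≠ v → y x = (1 - w.1 v)⁻¹ * w.1 x := fun x hx => by
      simp [y, Finsupp.erase_ne hx]
    have hyv : y v = 0 := by simp [y]
    have hy : ∀ x, y x ≠ 0 → w.1 x ≠ 0 ∧ x ≠ v := fun x hx => by
      have hxv : x ≠ v := by rintro rfl; exact hx hyv
      rw [hyx x hxv] at hx
      exact ⟨right_ne_zero_of_mul hx, hxv⟩
    refine ⟨⟨y, fun x => ?_, ?_, ?_⟩, ⟨w.1 v, w.2.1 v, by linarith⟩, Subtype.ext (Finsupp.ext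
      fun x => ?_), hy⟩
    · by_cases hx : x = v
      · rw [hx, hyv]
      · rw [hyx x hx]; exact mul_nonneg (inv_nonneg.2 hlt.le) (w.2.1 x)
    · rw [Finsupp.sum_smul_index' (by simp)]
      simp only [smul_eq_mul]
      rw [← Finsupp.mul_sum, show (w.1.erase v).sum (fun _ r => r) = 1 - w.1 v by linarith]
      exact inv_mul_cancel₀ hlt.ne'
    · by_cases hv : v ∈ t
      · obtain ⟨s, hs, rfl⟩ := h.face_of_mem t ht hv
        refine S.exists_face_of_subset hs fun x hx => ?_
        exact ((h.mem_ins s x).1 ((hw x).1 (hy x hx).1)).resolve_left (hy x hx).2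
      · exact S.exists_face_of_subset (h.face_of_not_mem t ht hv) fun x hx => (hw x).1 (hy x hx).1
    · change _ = joinPoint v y (w.1 v) x
      by_cases hx : x = v
      · rw [hx, joinPoint_self hyv]
      · rw [joinPoint_of_ne hx, hyx x hx, mul_inv_cancel_left₀ hlt.ne']

variable {Y : Type u} [TopologicalSpace Y] {nv : Prop}

/-- The map from the topological cone to the realization of the simplicial cone. -/
def coneMap (h : IsConePair S S' T T' v ins) (e : Y ≃ₜ Realization S) :
    Cone Y nv → Realization T :=
  Quot.lift (Sum.elim (fun p => h.point (e p.1) p.2) fun _ => h.apexPoint) (by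
    rintro _ _ ⟨y, -⟩
    exact h.point_one (e y))

lemma coneMap_point (h : IsConePair S S' T T' v ins) (e : Y ≃ₜ Realization S) (y : Y)
    (t : unitInterval) : h.coneMap e (Cone.point y t : Cone Y nv) = h.point (e y) t := rfl

lemma coneMap_apex (h : IsConePair S S' T T' v ins) (e : Y ≃ₜ Realization S) (hn : nv) :
    h.coneMap e (Cone.apex hn : Cone Y nv) = h.apexPoint := rfl

lemma continuous_coneMap (h : IsConePair S S' T T' v ins) (e : Y ≃ₜ Realization S) :
    Continuous (h.coneMap e : Cone Y nv → Realization T) := by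
  rw [Cone.continuous_iff]
  have he : Continuous fun p : Y × unitInterval => (e p.1, p.2) :=
    (e.continuous.comp continuous_fst).prodMk continuous_snd
  have := h.continuous_point.comp he
  exact this

end IsConePair

namespace IsConePair

variable {Y : Type u} [TopologicalSpace Y] {nv : Prop}

/-- The coordinate at `v` recovers the height `t`; for `t ≠ 1` the other coordinates, divided by `1
- t`, recover the base point. -/
lemma coneMap_bijective (h : IsConePair S S' T T' v ins) (e : Y ≃ₜ Realization S) (hn : nv) :
    Function.Bijective (h.coneMap e : Cone Y nv → Realization T) := by
  have hv : ∀ (y : Y) (t : unitInterval), (h.point (e y) t).1 v = t := fun y t =>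
    joinPoint_self (h.apply_eq_zero (e y)) _
  have ha : h.apexPoint.1 v = 1 := by simp [apexPoint]
  have hone : ∀ (y : Y) (t : unitInterval), (t : ℝ) = 1 →
      (Cone.point y t : Cone Y nv) = Cone.apex hn := fun y t ht => by
    rw [show t = 1 from Subtype.ext ht, Cone.point_one y hn]
  refine ⟨fun z z' hz => ?_, fun w => ?_⟩
  · rcases z.eq_apex_or_point with ⟨_, rfl⟩ | ⟨y, t, rfl⟩ <;>
      rcases z'.eq_apex_or_point with ⟨_, rfl⟩ | ⟨y', t', rfl⟩
    · rfl
    · rw [coneMap_apex, coneMap_point] at hz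
      refine (hone y' t' ?_).symm
      rw [← hv y', ← hz, ha]
    · rw [coneMap_apex, coneMap_point] at hz
      refine hone y t ?_
      rw [← hv y, hz, ha]
    · rw [coneMap_point, coneMap_point] at hz
      have htt : t = t' := Subtype.ext (by rw [← hv y, hz, hv])
      subst htt
      by_cases ht : (t : ℝ) = 1
      · rw [hone y t ht, hone y' t ht]
      · congr 1
        refine e.injective (Subtype.ext (Finsupp.ext fun x => ?_))
        by_cases hx : x = v
        · rw [hx, h.apply_eq_zero, h.apply_eq_zero]
        · have := congrArg (fun w : Realization T => w.1 x) hz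
          simp only [point, joinPoint_of_ne hx] at this
          exact mul_left_cancel₀ (sub_ne_zero.2 (Ne.symm ht)) this
  · rcases h.exists_point w with rfl | ⟨y, t, rfl, -⟩
    · exact ⟨Cone.apex hn, rfl⟩
    · exact ⟨Cone.point (e.symm y) t, by rw [coneMap_point, e.apply_symm_apply]⟩

/-- The topological cone on `|S|` is the realization of the simplicial cone. -/
def coneHomeomorph (h : IsConePair S S' T T' v ins) (e : Y ≃ₜ Realization S) (hn : nv) :
    Cone Y nv ≃ₜ Realization T where
  toEquiv := Equiv.ofBijective _ (h.coneMap_bijective e hn)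
  continuous_toFun := h.continuous_coneMap e
  continuous_invFun := by
    set E : Cone Y nv ≃ Realization T := Equiv.ofBijective _ (h.coneMap_bijective e hn) with hE
    change Continuous E.symm
    -- On a cell containing the apex, the inverse is tested after pulling back along `q`, a
    -- continuous surjection from the compact space `Cell S s × [0,1] ⊔ pt` onto a Hausdorff space,
    -- hence a quotient map. The extra point covers the apex even when `s` is empty.
    have key : ∀ s ∈ S.faces,
        Continuous fun w : Realization.Cell T (ins s) => E.symm w.1 := by
      intro s hs
      have := Realization.Cell.compactSpace hs
      let q : (Realization.Cell S s × unitInterval) ⊕ Unit → Realization.Cell T (ins s) :=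
        Sum.elim (fun p => ⟨h.point p.1.1 p.2, fun x => h.mem_ins_of_joinPoint_ne_zero p.1.2⟩)
          fun _ => ⟨h.apexPoint, fun x hx => (h.mem_ins s x).2 <| Or.inl <| by
            by_contra hne
            exact hx (by simp [apexPoint, hne])⟩
      have hqc : Continuous q := by
        refine continuous_sum_dom.2
          ⟨Realization.Cell.continuous_iff.2 fun x => ?_, continuous_const⟩
        exact h.continuous_point_coord s x
      have hqs : Function.Surjective q := by
        rintro ⟨w, hw⟩
        rcases h.exists_point w with rfl | ⟨y, t, rfl, hy⟩
        · exact ⟨Sum.inr (), rfl⟩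
        · exact ⟨Sum.inl (⟨y, fun x hx => ((h.mem_ins s x).1 (hw x (hy x hx).1)).resolve_left
            (hy x hx).2⟩, t), rfl⟩
      rw [(IsQuotientMap.of_surjective_continuous hqs hqc).continuous_iff]
      refine continuous_sum_dom.2 ⟨?_, continuous_of_const fun _ _ => rfl⟩
      have heq : ((fun w : Realization.Cell T (ins s) => E.symm w.1) ∘ q) ∘ Sum.inl =
          fun p : Realization.Cell S s × unitInterval =>
            (Cone.point (e.symm p.1.1) p.2 : Cone Y nv) := by
        funext p
        change E.symm (h.point p.1.1 p.2) = _
        rw [Equiv.symm_apply_eq, hE, Equiv.ofBijective_apply, coneMap_point, e.apply_symm_apply]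
      rw [heq]
      exact Cone.continuous_point.comp
        ((e.symm.continuous.comp (Realization.continuous_cell S hs)).prodMap continuous_id)
    rw [Realization.continuous_iff]
    intro t ht
    by_cases hv : v ∈ t
    · obtain ⟨s, hs, rfl⟩ := h.face_of_mem t ht hv
      exact key s hs
    -- A cell not containing the apex maps continuously into the cell of its join with the apex.
    · have hs := h.face_of_not_mem t ht hv
      let g : Realization.Cell T t → Realization.Cell T (ins t) := fun w =>
        ⟨w.1, fun x hx => (h.mem_ins t x).2 (Or.inr (w.2 x hx))⟩
      have hg : Continuous g := Realization.Cell.continuous_iff.2 fun x =>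
        Realization.Cell.continuous_coord T t x
      exact (key t hs).comp hg

/-! ### The subspace of the suspension in barycentric coordinates. -/

lemma isCarried_point_zero (h : IsConePair S S' T T' v ins) (w : Realization S) :
    IsCarried T' (h.point w 0).1 := by
  obtain ⟨s, hs, hw⟩ := w.2.2.2
  refine ⟨s, h.sub_of_not_mem s (h.base_mem s hs) (h.not_mem s hs), fun x => ?_⟩
  change joinPoint v w.1 0 x ≠ 0 ↔ _
  rw [joinPoint_zero]
  exact hw x

/-- The apex is the join of `v` with the empty simplex, so this is where a void `S'` and an empty
`S'` behave differently. -/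
lemma isCarried_apexPoint_iff (h : IsConePair S S' T T' v ins) :
    IsCarried T' h.apexPoint.1 ↔ [] ∈ S' := by
  classical
  rw [← h.ins_mem_sub [] h.nil_mem]
  refine isCarried_iff_mem h.sub_subset (h.ins_face _ h.nil_mem) fun x => ?_
  rw [h.mem_ins]
  simp [apexPoint, Finsupp.single_apply, eq_comm]

lemma isCarried_point_iff (h : IsConePair S S' T T' v ins) (w : Realization S)
    (t : unitInterval) (h0 : t ≠ 0) (h1 : t ≠ 1) :
    IsCarried T' (h.point w t).1 ↔ IsCarried S' w.1 := by
  obtain ⟨s, hs, hw⟩ := w.2.2.2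
  rw [isCarried_iff_mem h.base_sub_subset hs hw, ← h.ins_mem_sub s hs]
  refine isCarried_iff_mem h.sub_subset (h.ins_face s hs) fun x => ?_
  change joinPoint v w.1 t x ≠ 0 ↔ _
  rw [h.mem_ins, ← hw x]
  by_cases hx : x = v
  · subst hx
    rw [joinPoint_self (h.apply_eq_zero w)]
    exact ⟨fun _ => Or.inl rfl, fun _ => unitInterval.coe_ne_zero.2 h0⟩
  · have : (1 - (t : ℝ)) ≠ 0 := sub_ne_zero.2 fun h' => h1 (Subtype.ext h'.symm)
    rw [joinPoint_of_ne hx]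
    simp [hx, this]

/-- The suspension of a pair homeomorphic to `(|S|, |S'|)` is `(|T|, |T'|)`. -/
lemma mem_sus_sub_iff (h : IsConePair S S' T T' v ins) {P : SpacePair.{u}}
    (e : P.space ≃ₜ Realization S) (hn : P.spaceNonvoid) (hs : P.subNonvoid ↔ [] ∈ S')
    (he : ∀ y, y ∈ P.sub ↔ IsCarried S' (e y).1) (z : P.sus.space) :
    z ∈ P.sus.sub ↔
      IsCarried T' (h.coneHomeomorph e hn (show Cone P.space P.spaceNonvoid from z)).1 := by
  have hpt : ∀ y t, h.coneHomeomorph e hn (Cone.point y t) = h.point (e y) t := fun _ _ => rfl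
  have hap : h.coneHomeomorph e hn (Cone.apex hn) = h.apexPoint := rfl
  constructor
  · rintro (⟨y, hy, t, rfl⟩ | ⟨hP, _, rfl⟩ | ⟨y, rfl⟩)
    · change IsCarried T' (h.coneHomeomorph e hn (Cone.point y t)).1
      rw [hpt]
      by_cases h0 : t = 0
      · rw [h0]; exact h.isCarried_point_zero _
      by_cases h1 : t = 1
      · rw [h1, h.point_one, h.isCarried_apexPoint_iff]
        exact hs.1 (P.subNonvoid_of_mem y hy)
      · exact (h.isCarried_point_iff _ t h0 h1).2 ((he y).1 hy)
    · change IsCarried T' (h.coneHomeomorph e hn (Cone.apex hn)).1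
      rw [hap]
      exact h.isCarried_apexPoint_iff.2 (hs.1 hP)
    · change IsCarried T' (h.coneHomeomorph e hn (Cone.point y 0)).1
      rw [hpt]
      exact h.isCarried_point_zero _
  · have hapex : IsCarried T' h.apexPoint.1 → Cone.apex hn ∈ P.sus.sub := fun hz =>
      Or.inr (Or.inl ⟨hs.2 (h.isCarried_apexPoint_iff.1 hz), hn, rfl⟩)
    intro hz
    rcases Cone.eq_apex_or_point z with ⟨_, rfl⟩ | ⟨y, t, rfl⟩
    · exact hapex hz
    · change IsCarried T' (h.coneHomeomorph e hn (Cone.point y t)).1 at hz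
      rw [hpt] at hz
      by_cases h0 : t = 0
      · rw [h0]; exact Or.inr (Or.inr ⟨y, rfl⟩)
      by_cases h1 : t = 1
      · rw [h1, h.point_one] at hz
        rw [h1, Cone.point_one y hn]
        exact hapex hz
      · exact Or.inl ⟨y, (he y).2 ((h.isCarried_point_iff _ t h0 h1).1 hz), t, rfl⟩

end IsConePair

end ConeRealization

/-! ## Homeomorphic pairs -/

section HomeomorphicPairs

variable {Y Z : Type u} [TopologicalSpace Y] [TopologicalSpace Z]

lemma PairHomotopyEquiv.of_homeomorph (e : Y ≃ₜ Z) {A : Set Y} {B : Set Z}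
    (h : ∀ y, y ∈ A ↔ e y ∈ B) : PairHomotopyEquiv A B := by
  refine ⟨⟨e, e.continuous⟩, ⟨e.symm, e.symm.continuous⟩, fun y => (h y).1,
    fun z hz => (h _).2 (by simpa using hz), ?_, ?_⟩
  · have : (ContinuousMap.comp ⟨e.symm, e.symm.continuous⟩ ⟨e, e.continuous⟩ : C(Y, Y)) =
        ContinuousMap.id Y := ContinuousMap.ext e.symm_apply_apply
    rw [this]
    exact ContinuousMap.HomotopicWith.refl _ fun _ h => h
  · have : (ContinuousMap.comp ⟨e, e.continuous⟩ ⟨e.symm, e.symm.continuous⟩ : C(Z, Z)) =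
        ContinuousMap.id Z := ContinuousMap.ext e.apply_symm_apply
    rw [this]
    exact ContinuousMap.HomotopicWith.refl _ fun _ h => h

/-- The map of quotients induced by a map of pairs. -/
def Collapse.map {A : Set Y} {B : Set Z} (f : Y → Z) (h : ∀ y ∈ A, f y ∈ B) :
    Collapse A → Collapse B :=
  Quot.map (Sum.map f id) (by
    rintro _ _ ⟨y, hy⟩
    exact CollapseRel.glue (f y) (h y hy))

lemma Collapse.continuous_map {A : Set Y} {B : Set Z} {f : Y → Z} (h : ∀ y ∈ A, f y ∈ B)
    (hf : Continuous f) : Continuous (Collapse.map f h) :=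
  continuous_coinduced_dom.2 (continuous_quot_mk.comp (hf.sumMap continuous_id))

/-- A homeomorphism of pairs induces a homeomorphism of the quotients. -/
def Collapse.homeomorph (e : Y ≃ₜ Z) {A : Set Y} {B : Set Z} (h : ∀ y, y ∈ A ↔ e y ∈ B) :
    Collapse A ≃ₜ Collapse B where
  toFun := Collapse.map e fun y => (h y).1
  invFun := Collapse.map e.symm fun z hz => (h _).2 (by simpa using hz)
  left_inv z := by
    induction z using Quot.ind with
    | mk z =>
      rcases z with y | _
      · exact congrArg (fun y => Quot.mk _ (Sum.inl y)) (e.symm_apply_apply y)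
      · rfl
  right_inv z := by
    induction z using Quot.ind with
    | mk z =>
      rcases z with y | _
      · exact congrArg (fun y => Quot.mk _ (Sum.inl y)) (e.apply_symm_apply y)
      · rfl
  continuous_toFun := Collapse.continuous_map _ e.continuous
  continuous_invFun := Collapse.continuous_map _ e.symm.continuous

lemma Collapse.pairHomotopyEquiv_of_homeomorph (e : Y ≃ₜ Z) {A : Set Y} {B : Set Z}
    (h : ∀ y, y ∈ A ↔ e y ∈ B) :
    PairHomotopyEquiv {Collapse.base A} {Collapse.base B} :=
  PairHomotopyEquiv.of_homeomorph (Collapse.homeomorph e h) fun _ =>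
    (Collapse.homeomorph e h).injective.eq_iff.symm.trans Iff.rfl

omit [TopologicalSpace Y] in
lemma Collapse.eq_base {A : Set Y} (h : ∀ y, y ∈ A) (z : Collapse A) : z = Collapse.base A := by
  induction z using Quot.ind with
  | mk z =>
    rcases z with y | _
    · exact Quot.sound (CollapseRel.glue y (h y))
    · rfl

/-- If `A` and `B` are the whole spaces, then both quotients are points. -/
lemma Collapse.pairHomotopyEquiv_of_forall_mem {A : Set Y} {B : Set Z} (hA : ∀ y, y ∈ A)
    (hB : ∀ z, z ∈ B) : PairHomotopyEquiv {Collapse.base A} {Collapse.base B} := by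
  let e : Collapse A ≃ₜ Collapse B :=
    { toFun := fun _ => Collapse.base B
      invFun := fun _ => Collapse.base A
      left_inv := fun z => (Collapse.eq_base hA z).symm
      right_inv := fun z => (Collapse.eq_base hB z).symm
      continuous_toFun := continuous_const
      continuous_invFun := continuous_const }
  exact PairHomotopyEquiv.of_homeomorph e fun z =>
    ⟨fun _ => rfl, fun _ => Collapse.eq_base hA z⟩

end HomeomorphicPairs

/-! ## Chains in the causal poset -/

section CausalChains

variable {X : Type u} [MetricSpace X]

lemma Event.le_def {e f : Event X} : e ≤ f ↔ dist e.pt f.pt ≤ f.time - e.time := Iff.rfl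

lemma Event.time_lt_of_lt {e f : Event X} (h : e < f) : e.time < f.time := by
  by_contra hc
  have h1 := Event.le_def.1 h.le
  have h0 : 0 ≤ dist e.pt f.pt := dist_nonneg
  exact h.ne (Event.ext (dist_le_zero.1 (by linarith)) (by linarith))

/-- The causal inequalities of consecutive events telescope. -/
lemma eventLength_le_sub (s : List (Event X)) : ∀ e f : Event X,
    (e :: (s ++ [f])).Pairwise (· < ·) → eventLength (e :: (s ++ [f])) ≤ f.time - e.time := by
  induction s with
  | nil =>
    intro e f h
    have : e < f := by simpa using h
    simpa [eventLength, pathLength] using Event.le_def.1 this.le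
  | cons g s ih =>
    intro e f h
    rw [List.cons_append, List.pairwise_cons] at h
    have h1 := Event.le_def.1 (h.1 g (by simp)).le
    have h2 := ih g f h.2
    simp only [eventLength, List.cons_append, List.map_cons, pathLength] at h2 ⊢
    linarith

/-- The events at the points of `l`, visited one after the other at unit speed starting at the point
`x` at time `t`. -/
def eventsFrom : X → ℝ → List X → List (Event X)
  | _, _, [] => []
  | x, t, y :: l => ⟨y, t + dist x y⟩ :: eventsFrom y (t + dist x y) l

lemma map_pt_eventsFrom (l : List X) : ∀ (x : X) (t : ℝ), (eventsFrom x t l).map Event.pt = l := by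
  induction l with
  | nil => exact fun _ _ => rfl
  | cons y l ih => exact fun x t => by simp [eventsFrom, ih]

/-- Equality in the telescoped estimate forces equality at every step, so each time is the previous
one plus the distance travelled. A repeated point would then give equal times, which a strict chain
excludes. -/
lemma eq_eventsFrom (s : List (Event X)) : ∀ e f : Event X,
    (e :: (s ++ [f])).Pairwise (· < ·) → eventLength (e :: (s ++ [f])) = f.time - e.time →
      s = eventsFrom e.pt e.time (s.map Event.pt) ∧
        ((e :: (s ++ [f])).map Event.pt).IsChain (· ≠ ·) := by
  induction s with
  | nil =>
    intro e f h hl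
    have hef : e < f := by simpa using h
    refine ⟨rfl, ?_⟩
    simp only [eventLength, List.nil_append, List.map_cons, List.map_nil, pathLength,
      add_zero] at hl
    simp only [List.nil_append, List.map_cons, List.map_nil, List.isChain_cons_cons,
      List.isChain_singleton, and_true]
    intro hne
    rw [hne, dist_self] at hl
    linarith [Event.time_lt_of_lt hef]
  | cons g s ih =>
    intro e f h hl
    rw [List.cons_append, List.pairwise_cons] at h
    have heg := h.1 g (by simp)
    have h1 := Event.le_def.1 heg.le
    have h2 := eventLength_le_sub s g f h.2
    have hl' : dist e.pt g.pt + eventLength (g :: (s ++ [f])) = f.time - e.time := by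
      rw [← hl]; simp [eventLength, pathLength]
    obtain ⟨h3, h4⟩ := ih g f h.2 (by linarith)
    have hg : e.time + dist e.pt g.pt = g.time := by linarith
    refine ⟨?_, ?_⟩
    · rw [List.map_cons, eventsFrom, hg, ← h3]
    · rw [List.cons_append, List.map_cons, List.map_cons, List.isChain_cons_cons]
      refine ⟨fun hne => ?_, h4⟩
      rw [hne, dist_self] at hg
      linarith [Event.time_lt_of_lt heg]

lemma pairwise_eventsFrom (l : List X) : ∀ (x y : X) (t r : ℝ),
    (x :: (l ++ [y])).IsChain (· ≠ ·) → r = t + pathLength (x :: (l ++ [y])) →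
      (⟨x, t⟩ :: (eventsFrom x t l ++ [⟨y, r⟩]) : List (Event X)).Pairwise (· < ·) := by
  -- Since `<` is transitive, comparing neighbours is enough, and that form passes through the
  -- induction.
  suffices H : ∀ (x y : X) (t r : ℝ),
      (x :: (l ++ [y])).IsChain (· ≠ ·) → r = t + pathLength (x :: (l ++ [y])) →
        (⟨x, t⟩ :: (eventsFrom x t l ++ [⟨y, r⟩]) : List (Event X)).IsChain (· < ·) from
    fun x y t r h hr => (H x y t r h hr).pairwise
  induction l with
  | nil =>
    intro x y t r h hr
    have hxy : x ≠ y := by simpa using h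
    simp only [List.nil_append, pathLength, add_zero] at hr
    simp only [eventsFrom, List.nil_append, List.isChain_cons_cons, List.isChain_singleton,
      and_true]
    refine lt_of_le_of_ne (Event.le_def.2 ?_) fun he => hxy (congrArg Event.pt he)
    simp [hr]
  | cons z l ih =>
    intro x y t r h hr
    rw [List.cons_append, List.isChain_cons_cons] at h
    simp only [eventsFrom, List.cons_append, List.isChain_cons_cons]
    refine ⟨lt_of_le_of_ne (Event.le_def.2 ?_) fun he => h.1 (congrArg Event.pt he), ?_⟩
    · simp
    · refine ih z y _ r h.2 ?_
      rw [hr]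
      simp only [List.cons_append, pathLength]
      ring

/-- Splitting the itinerary at the event supplies the witnesses `p`, `q` required for it to be
essential. -/
lemma exists_of_mem_eventsFrom (l : List X) : ∀ (x : X) (t : ℝ), ∀ e ∈ eventsFrom x t l,
    ∃ p q : List X, l = p ++ e.pt :: q ∧ e.time = t + pathLength (x :: (p ++ [e.pt])) := by
  induction l with
  | nil => intro x t e he; simp [eventsFrom] at he
  | cons y l ih =>
    intro x t e he
    rw [eventsFrom, List.mem_cons] at he
    rcases he with rfl | he
    · exact ⟨[], l, rfl, by simp [pathLength]⟩
    · obtain ⟨p, q, h1, h2⟩ := ih y _ e he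
      refine ⟨y :: p, q, by rw [h1]; rfl, ?_⟩
      rw [h2]
      simp only [List.cons_append, pathLength]
      ring

end CausalChains

/-! ## The essential poset -/

section Essential

variable {X : Type u} [MetricSpace X] {a b : X} {ℓ : ℝ}

lemma bot_lt_of_mem_innerPoset {e : Event X} (he : e ∈ innerPoset a b ℓ) : ⟨a, 0⟩ < e :=
  lt_of_le_of_ne he.1.1.1 fun h => he.2 (Or.inl h.symm)

lemma lt_top_of_mem_innerPoset {e : Event X} (he : e ∈ innerPoset a b ℓ) : e < ⟨b, ℓ⟩ :=
  lt_of_le_of_ne he.1.1.2 fun h => he.2 (Or.inr h)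

lemma bot_lt_top (hℓ : 0 < ℓ) (hab : dist a b ≤ ℓ) : (⟨a, 0⟩ : Event X) < ⟨b, ℓ⟩ :=
  lt_of_le_of_ne (Event.le_def.2 (by simpa using hab)) fun h =>
    hℓ.ne (congrArg Event.time h)

/-- The path witnessing any essential event also witnesses the start, once `a` is repeated at cost
0; the end is handled by repeating `b`. -/
lemma bot_mem_essential (hℓ : 0 < ℓ) (hab : dist a b ≤ ℓ) (h : (essential a b ℓ).Nonempty) :
    (⟨a, 0⟩ : Event X) ∈ essential a b ℓ := by
  obtain ⟨e, -, p, q, -, h⟩ := h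
  exact ⟨⟨le_rfl, (bot_lt_top hℓ hab).le⟩, [], p ++ e.pt :: q, by simp [pathLength],
    by simpa [pathLength] using h⟩

lemma top_mem_essential (hℓ : 0 < ℓ) (hab : dist a b ≤ ℓ) (h : (essential a b ℓ).Nonempty) :
    (⟨b, ℓ⟩ : Event X) ∈ essential a b ℓ := by
  obtain ⟨e, -, p, q, -, h⟩ := h
  have h' : pathLength ((a :: (p ++ e.pt :: q)) ++ [b]) = ℓ := by simpa using h
  have h2 := pathLength_append (a :: (p ++ e.pt :: q)) b [b]
  refine ⟨⟨(bot_lt_top hℓ hab).le, le_rfl⟩, p ++ e.pt :: q, [], by simpa using h'.symm, ?_⟩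
  simp only [List.append_assoc, List.cons_append, List.nil_append, pathLength, dist_self] at h' h2 ⊢
  linarith

lemma pairwise_bot_top (hℓ : 0 < ℓ) (hab : dist a b ≤ ℓ) {s : List (Event X)}
    (hs : s ∈ (orderComplex (innerPoset a b ℓ)).faces) :
    (⟨a, 0⟩ :: (s ++ [⟨b, ℓ⟩])).Pairwise (· < ·) := by
  rw [List.pairwise_cons, List.pairwise_append]
  refine ⟨fun e he => ?_, hs.1, List.pairwise_singleton _ _, fun e he f hf => ?_⟩
  · rw [List.mem_append, List.mem_singleton] at he
    rcases he with he | rfl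
    exacts [bot_lt_of_mem_innerPoset (hs.2 e he), bot_lt_top hℓ hab]
  · rw [List.mem_singleton] at hf
    exact hf ▸ lt_top_of_mem_innerPoset (hs.2 e he)

/-- The clause `d(a,b) < ℓ` is redundant by the triangle inequality: `[a, b]` is a sublist of the
capped sequence. -/
lemma mem_aiComplexDot_iff {s : List (Event X)} (hs : s ∈ (aiComplex a b ℓ).faces) :
    s ∈ (aiComplexDot a b ℓ).faces ↔ pathLength (a :: (s.map Event.pt ++ [b])) < ℓ := by
  refine ⟨fun h => h.2.2, fun h => ⟨hs, ?_, h⟩⟩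
  have hsub : [a, b].Sublist (a :: (s.map Event.pt ++ [b])) :=
    (List.sublist_append_right _ _).cons_cons a
  have := pathLength_sublist hsub
  simp only [pathLength, add_zero] at this
  exact this.trans_lt h

variable (a b ℓ)

/-- The order complex of `𝒦 ∪ {(a, 0)}`. -/
def botConeComplex : OrdComplex (Event X) :=
  orderComplex (insert ⟨a, 0⟩ (innerPoset a b ℓ))

/-- The chains in `𝒦 ∪ {(a, 0)}` with `d(x₀, …, xₖ, b) < ℓ`. -/
def botConeDot : Set (List (Event X)) :=
  {t | t ∈ (botConeComplex a b ℓ).faces ∧ pathLength (t.map Event.pt ++ [b]) < ℓ}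

variable {a b ℓ}

/-- A chain without `(a, 0)` starts at a positive time, so reaching `b` at time `ℓ` leaves it length
less than `ℓ`. With `(a, 0)` in front, the length condition is the one defining `K'_ℓ`. -/
lemma isConePair_bot (hℓ : 0 < ℓ) (hab : dist a b ≤ ℓ) :
    IsConePair (aiComplex a b ℓ) (aiComplexDot a b ℓ).faces (botConeComplex a b ℓ)
      (botConeDot a b ℓ) ⟨a, 0⟩ (List.cons ⟨a, 0⟩) where
  nil_mem := ⟨hab, List.Pairwise.nil, by simp⟩
  not_mem s hs h := (bot_lt_of_mem_innerPoset (hs.2.2 _ h)).ne rfl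
  mem_ins _ _ := List.mem_cons
  base_mem s hs := ⟨hs.2.1, fun v hv => Or.inr (hs.2.2 v hv)⟩
  ins_face s hs := by
    refine ⟨List.pairwise_cons.2 ⟨fun e he => bot_lt_of_mem_innerPoset (hs.2.2 e he), hs.2.1⟩,
      fun v hv => ?_⟩
    rcases List.mem_cons.1 hv with rfl | hv
    exacts [Or.inl rfl, Or.inr (hs.2.2 v hv)]
  face_of_not_mem t ht h :=
    ⟨hab, ht.1, fun v hv => (ht.2 v hv).resolve_left (by rintro rfl; exact h hv)⟩
  face_of_mem t ht h := by
    rcases t with _ | ⟨x, s⟩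
    · simp at h
    · have hp := List.pairwise_cons.1 ht.1
      rcases ht.2 x (by simp) with rfl | hx
      · refine ⟨s, ⟨hab, hp.2, fun v hv => ?_⟩, rfl⟩
        exact (ht.2 v (List.mem_cons_of_mem _ hv)).resolve_left (hp.1 v hv).ne'
      · have hbx := bot_lt_of_mem_innerPoset hx
        rcases List.mem_cons.1 h with h | h
        · exact absurd h hbx.ne
        · exact absurd (hp.1 _ h) hbx.asymm
  base_sub_subset s hs := hs.1
  sub_subset t ht := ht.1
  sub_of_not_mem t ht h := by
    refine ⟨ht, ?_⟩
    have hin : ∀ v ∈ t, v ∈ innerPoset a b ℓ := fun v hv =>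
      (ht.2 v hv).resolve_left (by rintro rfl; exact h hv)
    rcases t with _ | ⟨x, s⟩
    -- The empty chain gives the one-point sequence `b`, of length 0.
    · simpa [pathLength] using hℓ
    · have hp := pairwise_bot_top hℓ hab ⟨ht.1, hin⟩
      rw [List.cons_append, List.pairwise_cons] at hp
      have h1 := eventLength_le_sub s x ⟨b, ℓ⟩ hp.2
      have h2 := Event.time_lt_of_lt (hp.1 x (by simp))
      simp only [eventLength, List.map_cons, List.map_append, List.map_nil, List.cons_append]
        at h1 h2 ⊢
      linarith
  ins_mem_sub s hs := by
    rw [mem_aiComplexDot_iff hs]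
    refine ⟨fun h => h.2, fun h => ⟨?_, h⟩⟩
    refine ⟨List.pairwise_cons.2 ⟨fun e he => bot_lt_of_mem_innerPoset (hs.2.2 e he), hs.2.1⟩,
      fun v hv => ?_⟩
    rcases List.mem_cons.1 hv with rfl | hv
    exacts [Or.inl rfl, Or.inr (hs.2.2 v hv)]

lemma insert_bot_innerPoset (hℓ : 0 < ℓ) (hab : dist a b ≤ ℓ) (h : (essential a b ℓ).Nonempty)
    {e : Event X} : e ∈ insert ⟨a, 0⟩ (innerPoset a b ℓ) ↔ e ∈ essential a b ℓ ∧ e ≠ ⟨b, ℓ⟩ := by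
  constructor
  · rintro (rfl | he)
    · exact ⟨bot_mem_essential hℓ hab h, (bot_lt_top hℓ hab).ne⟩
    · exact ⟨he.1, fun h => he.2 (Or.inr h)⟩
  · rintro ⟨h1, h2⟩
    by_cases he : e = ⟨a, 0⟩
    · exact Or.inl he
    · exact Or.inr ⟨h1, by rintro (h | h); exacts [he h, h2 h]⟩

lemma mem_essComplexDot_iff {s : List (Event X)} :
    s ∈ (essComplexDot a b ℓ).faces ↔ s ∈ (essComplex a b ℓ).faces ∧ eventLength s < ℓ :=
  ⟨fun h => ⟨h.1, h.2.2⟩, fun h => ⟨h.1, ⟨h.1.1, fun v hv => (h.1.2 v hv).1⟩, h.2⟩⟩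

lemma append_top_mem_essComplex (hℓ : 0 < ℓ) (hab : dist a b ≤ ℓ)
    (h : (essential a b ℓ).Nonempty) {s : List (Event X)}
    (hs : s ∈ (botConeComplex a b ℓ).faces) : s ++ [⟨b, ℓ⟩] ∈ (essComplex a b ℓ).faces := by
  refine ⟨List.pairwise_append.2 ⟨hs.1, List.pairwise_singleton _ _, fun e he f hf => ?_⟩,
    fun v hv => ?_⟩
  · rw [List.mem_singleton] at hf
    have := (insert_bot_innerPoset hℓ hab h).1 (hs.2 e he)
    exact hf ▸ lt_of_le_of_ne this.1.1.2 this.2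
  · rw [List.mem_append, List.mem_singleton] at hv
    rcases hv with hv | rfl
    exacts [((insert_bot_innerPoset hℓ hab h).1 (hs.2 v hv)).1, top_mem_essential hℓ hab h]

/-- A chain without `(b, ℓ)` starts no earlier than time 0 and ends before `ℓ`, so its length is
less than `ℓ`. Nonemptiness of the essential poset ensures that the two cone points belong to it. -/
lemma isConePair_top (hℓ : 0 < ℓ) (hab : dist a b ≤ ℓ) (h : (essential a b ℓ).Nonempty) :
    IsConePair (botConeComplex a b ℓ) (botConeDot a b ℓ) (essComplex a b ℓ)
      (essComplexDot a b ℓ).faces ⟨b, ℓ⟩ (· ++ [⟨b, ℓ⟩]) where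
  nil_mem := ⟨List.Pairwise.nil, by simp⟩
  not_mem s hs hv := ((insert_bot_innerPoset hℓ hab h).1 (hs.2 _ hv)).2 rfl
  mem_ins s x := by simp [or_comm]
  base_mem s hs := ⟨hs.1, fun v hv => ((insert_bot_innerPoset hℓ hab h).1 (hs.2 v hv)).1⟩
  ins_face s hs := append_top_mem_essComplex hℓ hab h hs
  face_of_not_mem t ht hv :=
    ⟨ht.1, fun v hv' => (insert_bot_innerPoset hℓ hab h).2
      ⟨ht.2 v hv', by rintro rfl; exact hv hv'⟩⟩
  face_of_mem t ht hv := by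
    rcases List.eq_nil_or_concat' t with rfl | ⟨s, x, rfl⟩
    · simp at hv
    · have hp := List.pairwise_append.1 ht.1
      have hx : ∀ v ∈ s, v < x := fun v hv => hp.2.2 v hv x (by simp)
      have hxb : x = ⟨b, ℓ⟩ := by
        rw [List.mem_append, List.mem_singleton] at hv
        rcases hv with hv | hv
        · exact absurd (ht.2 x (by simp)).1.2 (hx _ hv).not_ge
        · exact hv.symm
      subst hxb
      exact ⟨s, ⟨hp.1, fun v hv => (insert_bot_innerPoset hℓ hab h).2
        ⟨ht.2 v (by simp [hv]), (hx v hv).ne⟩⟩, rfl⟩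
  base_sub_subset s hs := hs.1
  sub_subset t ht := ht.1
  sub_of_not_mem t ht hv := by
    refine mem_essComplexDot_iff.2 ⟨ht, ?_⟩
    have hlt : ∀ e ∈ t, e < ⟨b, ℓ⟩ := fun e he =>
      lt_of_le_of_ne (ht.2 e he).1.2 (by rintro rfl; exact hv he)
    rcases t with _ | ⟨x, s⟩
    · simpa [eventLength, pathLength] using hℓ
    · have hp : (x :: (s ++ [⟨b, ℓ⟩])).Pairwise (· < ·) := by
        rw [← List.cons_append, List.pairwise_append]
        refine ⟨ht.1, List.pairwise_singleton _ _, fun e he f hf => ?_⟩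
        rw [List.mem_singleton] at hf
        exact hf ▸ hlt e he
      rcases List.eq_nil_or_concat' s with rfl | ⟨r, y, rfl⟩
      · simpa [eventLength, pathLength] using hℓ
      · have h1 := eventLength_le_sub r x y ht.1
        have h2 := Event.time_lt_of_lt (hlt y (by simp))
        have h3 := Event.le_def.1 (ht.2 x (by simp)).1.1
        have h4 : 0 ≤ dist (⟨a, 0⟩ : Event X).pt x.pt := dist_nonneg
        simp only at h2 h3 h4
        linarith
  ins_mem_sub s hs := by
    rw [mem_essComplexDot_iff]
    refine ⟨fun h' => ⟨hs, by simpa [eventLength] using h'.2⟩, fun h' =>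
      ⟨append_top_mem_essComplex hℓ hab h hs, by simpa [eventLength] using h'.2⟩⟩

lemma exists_homeomorph (hℓ : 0 < ℓ) (hab : dist a b ≤ ℓ) (h : (essential a b ℓ).Nonempty) :
    ∃ e : (aiPair a b ℓ).sus.sus.space ≃ₜ (essPair a b ℓ).space,
      ∀ y, y ∈ (aiPair a b ℓ).sus.sus.sub ↔ e y ∈ (essPair a b ℓ).sub := by
  have h1 := isConePair_bot hℓ hab
  have h2 := isConePair_top hℓ hab h
  have hn : (aiPair a b ℓ).spaceNonvoid := h1.nil_mem
  let e0 : (aiPair a b ℓ).space ≃ₜ Realization (aiComplex a b ℓ) := Homeomorph.refl _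
  let e1 : (aiPair a b ℓ).sus.space ≃ₜ Realization (botConeComplex a b ℓ) :=
    h1.coneHomeomorph e0 hn
  -- After one suspension the subspace contains the base, which is not the void, so both sides hold
  -- whether or not `K'_ℓ` is void.
  have hs1 : (aiPair a b ℓ).sus.subNonvoid ↔ [] ∈ botConeDot a b ℓ :=
    ⟨fun _ => h1.sub_of_not_mem [] h2.nil_mem (by simp), fun _ => Or.inr hn⟩
  exact ⟨h2.coneHomeomorph e1 hn, fun y => h2.mem_sus_sub_iff e1 hn hs1
    (h1.mem_sus_sub_iff e0 hn Iff.rfl fun _ => Iff.rfl) y⟩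

lemma pairHomotopyEquiv_essPair (hℓ : 0 < ℓ) (hab : dist a b ≤ ℓ)
    (h : (essential a b ℓ).Nonempty) :
    PairHomotopyEquiv (essPair a b ℓ).sub (aiPair a b ℓ).sus.sus.sub := by
  obtain ⟨e, he⟩ := exists_homeomorph hℓ hab h
  exact PairHomotopyEquiv.of_homeomorph e.symm fun y => by rw [he]; simp

lemma collapse_pairHomotopyEquiv (hℓ : 0 < ℓ) (hab : dist a b ≤ ℓ) :
    PairHomotopyEquiv {Collapse.base (essPair a b ℓ).sub}
      {Collapse.base (aiPair a b ℓ).sus.sus.sub} := by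
  by_cases h : (essential a b ℓ).Nonempty
  · obtain ⟨e, he⟩ := exists_homeomorph hℓ hab h
    exact Collapse.pairHomotopyEquiv_of_homeomorph e.symm fun y => by rw [he]; simp
  -- If `d(a,b) = ℓ`, the direct path from `a` to `b` would make `(a, 0)` essential.
  · have hlt : dist a b < ℓ := lt_of_le_of_ne hab fun heq => h
      ⟨⟨a, 0⟩, ⟨le_rfl, (bot_lt_top hℓ hab).le⟩, [], [], by simp [pathLength],
        by simpa [pathLength] using heq⟩
    have hempty : ∀ S : OrdComplex (Event X), (∀ s ∈ S.faces, ∀ v ∈ s, v ∈ essential a b ℓ) →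
        IsEmpty (Realization S) := by
      refine fun S hS => ⟨fun w => ?_⟩
      obtain ⟨s, hs, hw⟩ := w.2.2.2
      have hzero : w.1 = 0 := Finsupp.ext fun v =>
        not_not.1 fun hv => h ⟨v, hS s hs v ((hw v).1 hv)⟩
      have hsum : w.1.sum (fun _ r => r) = 1 := w.2.2.1
      rw [hzero, Finsupp.sum_zero_index] at hsum
      exact zero_ne_one hsum
    have hess : IsEmpty (essPair a b ℓ).space := hempty _ fun s hs => hs.2
    have hai : IsEmpty (aiPair a b ℓ).space := hempty _ fun s hs v hv => (hs.2.2 v hv).1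
    have hsub : (aiPair a b ℓ).subNonvoid :=
      (mem_aiComplexDot_iff (isConePair_bot hℓ hab).nil_mem).2 (by simpa [pathLength] using hlt)
    have hn := (aiPair a b ℓ).spaceNonvoid_of_sub hsub
    -- The first suspension consists of the apex alone, and the apex lies in the subspace because
    -- `K'_ℓ` contains the empty simplex.
    have hsus : ∀ z, z ∈ (aiPair a b ℓ).sus.sub := fun z => by
      rcases Cone.eq_apex_or_point z with ⟨_, rfl⟩ | ⟨y, _, _⟩
      exacts [Or.inr (Or.inl ⟨hsub, hn, rfl⟩), hai.elim y]
    refine Collapse.pairHomotopyEquiv_of_forall_mem (fun y => hess.elim y) fun z => ?_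
    rcases Cone.eq_apex_or_point z with ⟨_, rfl⟩ | ⟨y, t, rfl⟩
    exacts [Or.inr (Or.inl ⟨Or.inl hsub, hn, rfl⟩), Or.inl ⟨y, hsus y, t, rfl⟩]

end Essential

/-! ## Magnitude homology as the homology of the inner pair -/

section MagHomology

open CategoryTheory

variable {X : Type u} [MetricSpace X] {a b : X} {ℓ : ℝ}

lemma pathLength_cap_le (hℓ : 0 < ℓ) {s : List (Event X)} (hs : s ∈ (aiComplex a b ℓ).faces) :
    pathLength (a :: (s.map Event.pt ++ [b])) ≤ ℓ := by
  simpa [eventLength] using eventLength_le_sub s _ _ (pairwise_bot_top hℓ hs.1 hs.2)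

lemma eq_eventsFrom_of_pathLength_cap (hℓ : 0 < ℓ) {s : List (Event X)}
    (hs : s ∈ (aiComplex a b ℓ).faces) (h : pathLength (a :: (s.map Event.pt ++ [b])) = ℓ) :
    s = eventsFrom a 0 (s.map Event.pt) ∧ (a :: (s.map Event.pt ++ [b])).IsChain (· ≠ ·) := by
  simpa using eq_eventsFrom s _ _ (pairwise_bot_top hℓ hs.1 hs.2)
    (by simpa [eventLength] using h)

lemma isMagSeq_cap_iff (hℓ : 0 < ℓ) {s : List (Event X)} (hs : s ∈ (aiComplex a b ℓ).faces) :
    IsMagSeq a b ℓ (a :: (s.map Event.pt ++ [b])) ↔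
      pathLength (a :: (s.map Event.pt ++ [b])) = ℓ :=
  ⟨fun h => h.2.2.2, fun h =>
    ⟨rfl, by rw [← List.cons_append, List.getLast?_concat],
      (eq_eventsFrom_of_pathLength_cap hℓ hs h).2, h⟩⟩

/-- Capped lengths never exceed `ℓ`, and at length exactly `ℓ` consecutive points are automatically
distinct. So the simplices outside `K'_ℓ` are those that cap to magnitude generators. -/
lemma mem_aiComplexDot_iff_not_isMagSeq (hℓ : 0 < ℓ) {s : List (Event X)}
    (hs : s ∈ (aiComplex a b ℓ).faces) : s ∈ (aiComplexDot a b ℓ).faces ↔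
      ¬ IsMagSeq a b ℓ (a :: (s.map Event.pt ++ [b])) := by
  rw [mem_aiComplexDot_iff hs, isMagSeq_cap_iff hℓ hs, lt_iff_le_and_ne]
  exact and_iff_right (pathLength_cap_le hℓ hs)

lemma IsMagSeq.exists_eq (hℓ : 0 < ℓ) {l : List X} (hl : IsMagSeq a b ℓ l) :
    ∃ m : List X, l = a :: (m ++ [b]) := by
  obtain ⟨h1, h2, -, h4⟩ := hl
  rcases l with _ | ⟨x, l⟩
  · simp at h1
  · obtain rfl : x = a := by simpa using h1
    rcases List.eq_nil_or_concat' l with rfl | ⟨m, y, rfl⟩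
    -- A one-term sequence has length 0, so the two ends are separate entries.
    · exact absurd h4 hℓ.ne
    · rw [← List.cons_append, List.getLast?_concat] at h2
      obtain rfl : y = b := by simpa using h2
      exact ⟨m, rfl⟩

lemma eventsFrom_mem_aiComplex (hab : dist a b ≤ ℓ) {m : List X}
    (hm : IsMagSeq a b ℓ (a :: (m ++ [b]))) : eventsFrom a 0 m ∈ (aiComplex a b ℓ).faces := by
  have hp := pairwise_eventsFrom m a b 0 ℓ hm.2.2.1 (by rw [hm.2.2.2, zero_add])
  obtain ⟨hbot, hp⟩ := List.pairwise_cons.1 hp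
  obtain ⟨hp, -, htop⟩ := List.pairwise_append.1 hp
  refine ⟨hab, hp, fun e he => ?_⟩
  have h1 : ⟨a, 0⟩ < e := hbot e (by simp [he])
  have h2 : e < ⟨b, ℓ⟩ := htop e he _ (by simp)
  obtain ⟨p, q, h3, h4⟩ := exists_of_mem_eventsFrom m a 0 e he
  refine ⟨⟨⟨h1.le, h2.le⟩, p, q, by rw [h4, zero_add], ?_⟩, ?_⟩
  · have := hm.2.2.2
    rwa [h3, List.append_assoc, List.cons_append] at this
  · rintro (rfl | h)
    exacts [h1.ne rfl, h2.ne h]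

/-! ### The comparison of chain groups and differentials. -/

variable (a b ℓ)

/-- The map sending a simplex `(x₀, t₀) < ⋯ < (xₖ, tₖ)` to `(a, x₀, …, xₖ, b)` if this is a magnitude
sequence, and to `0` otherwise. -/
def capMap : (List (Event X) →₀ ℤ) →ₗ[ℤ] (List X →₀ ℤ) :=
  magProj a b ℓ ∘ₗ Finsupp.lmapDomain ℤ ℤ fun s => a :: (s.map Event.pt ++ [b])

variable {a b ℓ}

open Classical in
lemma capMap_single (s : List (Event X)) : capMap a b ℓ (Finsupp.single s 1) =
    if IsMagSeq a b ℓ (a :: (s.map Event.pt ++ [b])) then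
      Finsupp.single (a :: (s.map Event.pt ++ [b])) 1 else 0 := by
  rw [capMap, LinearMap.comp_apply, Finsupp.lmapDomain_apply, Finsupp.mapDomain_single,
    magProj_single]

lemma supported_le_of_single_mem {ι : Type*} {F : Set ι} {p : Submodule ℤ (ι →₀ ℤ)}
    (h : ∀ s ∈ F, Finsupp.single s 1 ∈ p) : Finsupp.supported ℤ ℤ F ≤ p := by
  rw [Finsupp.supported_eq_span_single, Submodule.span_le]
  rintro _ ⟨s, hs, rfl⟩
  exact h s hs

lemma capMap_mem {n k : ℤ} (hk : n + 2 = k) (c : List (Event X) →₀ ℤ)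
    (hc : c ∈ simpChains (aiComplex a b ℓ) n) : capMap a b ℓ c ∈ magChains a b ℓ k := by
  refine supported_le_of_single_mem (p := (magChains a b ℓ k).comap (capMap a b ℓ))
    (fun s hs => ?_) hc
  rw [Submodule.mem_comap, capMap_single]
  split_ifs with h
  · refine Finsupp.single_mem_supported ℤ _ ⟨?_, h⟩
    have := hs.2
    simp only [List.length_cons, List.length_append, List.length_map, List.length_nil]
    push_cast
    omega
  · exact Submodule.zero_mem _

/-- Capping moves entry `i` to position `i + 1`, whence the sign; the two added ends are never
removed by the magnitude boundary. A simplex of `K'_ℓ` and all its faces map to 0. -/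
lemma capMap_boundary (hℓ : 0 < ℓ) {n : ℤ} (c : List (Event X) →₀ ℤ)
    (hc : c ∈ simpChains (aiComplex a b ℓ) n) :
    magBoundary X ℓ (capMap a b ℓ c) = -capMap a b ℓ (boundary (Event X) c) := by
  classical
  rw [eq_neg_iff_add_eq_zero]
  refine supported_le_of_single_mem (p := LinearMap.ker
    (magBoundary X ℓ ∘ₗ capMap a b ℓ + capMap a b ℓ ∘ₗ boundary (Event X))) (fun s hs => ?_) hc
  obtain ⟨hs, -⟩ := hs
  have hface : ∀ i, (aiComplex a b ℓ).faces (s.eraseIdx i) := fun i =>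
    (aiComplex a b ℓ).down_closed s hs _ (List.eraseIdx_sublist s i)
  rw [LinearMap.mem_ker, LinearMap.add_apply, LinearMap.comp_apply, LinearMap.comp_apply,
    boundary_single, map_sum, capMap_single]
  simp only [map_smul, capMap_single]
  split_ifs with h
  · rw [magBoundary_single]
    have hlen : (a :: (s.map Event.pt ++ [b])).length - 1 = s.length + 1 := by simp
    rw [hlen, Finset.sum_Ico_eq_sum_range, Nat.add_sub_cancel, ← Finset.sum_add_distrib]
    refine Finset.sum_eq_zero fun i hi => ?_
    rw [Finset.mem_range] at hi
    have he : (a :: (s.map Event.pt ++ [b])).eraseIdx (1 + i) =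
        a :: ((s.eraseIdx i).map Event.pt ++ [b]) := by
      rw [add_comm, List.eraseIdx_cons_succ, List.eraseIdx_append_of_lt_length (by simpa using hi),
        List.eraseIdx_map]
    rw [magFace, he, if_congr (isMagSeq_cap_iff hℓ (hface i)) rfl rfl, pow_add, pow_one,
      neg_one_mul, neg_smul, neg_add_cancel]
  · rw [map_zero, zero_add]
    refine Finset.sum_eq_zero fun i _ => ?_
    have hdot := (aiComplexDot a b ℓ).down_closed s
      ((mem_aiComplexDot_iff_not_isMagSeq hℓ hs).2 h) _ (List.eraseIdx_sublist s i)
    rw [if_neg ((mem_aiComplexDot_iff_not_isMagSeq hℓ (hface i)).1 hdot), smul_zero]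

variable (a b ℓ)

/-- The map `C_n(K_ℓ) → MC_{n+2}^ℓ(X; a, b)`. -/
def capChains {n k : ℤ} (hk : n + 2 = k) :
    simpChains (aiComplex a b ℓ) n →ₗ[ℤ] magChains a b ℓ k :=
  (capMap a b ℓ).restrict fun c hc => capMap_mem hk c hc

variable {a b ℓ}

lemma capChains_surjective (hℓ : 0 < ℓ) (hab : dist a b ≤ ℓ) {n k : ℤ} (hk : n + 2 = k) :
    Function.Surjective (capChains a b ℓ hk) := by
  classical
  rintro ⟨c, hc⟩
  have hle : magChains a b ℓ k ≤ (simpChains (aiComplex a b ℓ) n).map (capMap a b ℓ) := by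
    refine supported_le_of_single_mem fun l hl => ?_
    obtain ⟨hlen, hl⟩ := hl
    obtain ⟨m, rfl⟩ := hl.exists_eq hℓ
    refine ⟨Finsupp.single (eventsFrom a 0 m) 1, Finsupp.single_mem_supported ℤ _
      ⟨eventsFrom_mem_aiComplex hab hl, ?_⟩, ?_⟩
    · have h := congrArg List.length (map_pt_eventsFrom m a 0)
      rw [List.length_map] at h
      rw [h]
      simp only [List.length_cons, List.length_append, List.length_nil] at hlen
      push_cast at hlen
      omega
    · rw [capMap_single, map_pt_eventsFrom, if_pos hl]
  obtain ⟨d, hd, rfl⟩ := hle hc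
  exact ⟨⟨d, hd⟩, rfl⟩

/-- Only simplices of `K'_ℓ` are killed, and on the others capping is injective, since the times are
recovered from the points. -/
lemma ker_capChains (hℓ : 0 < ℓ) {n k : ℤ} (hk : n + 2 = k) :
    (simpChains (aiComplexDot a b ℓ) n).submoduleOf (simpChains (aiComplex a b ℓ) n) =
      LinearMap.ker (capChains a b ℓ hk) := by
  classical
  ext ⟨c, hc⟩
  rw [LinearMap.mem_ker, Subtype.ext_iff]
  change c ∈ simpChains (aiComplexDot a b ℓ) n ↔ capMap a b ℓ c = 0
  constructor
  · intro hd
    refine supported_le_of_single_mem (p := LinearMap.ker (capMap a b ℓ)) (fun s hs => ?_) hd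
    rw [LinearMap.mem_ker, capMap_single,
      if_neg ((mem_aiComplexDot_iff_not_isMagSeq hℓ hs.1.1).1 hs.1)]
  · intro h0
    -- Removing both ends and restoring the times undoes the capping modulo chains of `K'_ℓ`; a
    -- chain with zero image is therefore itself such a chain.
    let back : (List X →₀ ℤ) →ₗ[ℤ] (List (Event X) →₀ ℤ) :=
      Finsupp.lmapDomain ℤ ℤ fun l => eventsFrom a 0 l.tail.dropLast
    have key : c - back (capMap a b ℓ c) ∈ simpChains (aiComplexDot a b ℓ) n := by
      refine supported_le_of_single_mem (p := (simpChains (aiComplexDot a b ℓ) n).comap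
        (LinearMap.id - back ∘ₗ capMap a b ℓ)) (fun s hs => ?_) hc
      rw [Submodule.mem_comap, LinearMap.sub_apply, LinearMap.comp_apply, capMap_single,
        LinearMap.id_apply]
      split_ifs with h
      · have hb : eventsFrom a 0 (a :: (s.map Event.pt ++ [b])).tail.dropLast = s := by
          rw [List.tail_cons, List.dropLast_concat]
          exact (eq_eventsFrom_of_pathLength_cap hℓ hs.1 h.2.2.2).1.symm
        rw [Finsupp.lmapDomain_apply, Finsupp.mapDomain_single, hb, sub_self]
        exact Submodule.zero_mem _
      · rw [map_zero, sub_zero]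
        exact Finsupp.single_mem_supported ℤ _
          ⟨(mem_aiComplexDot_iff_not_isMagSeq hℓ hs.1).2 h, hs.2⟩
    rwa [h0, map_zero, sub_zero] at key

/-- The isomorphism `C_n(K_ℓ, K'_ℓ) ≅ MC_{n+2}^ℓ(X; a, b)`. -/
def capEquiv (hℓ : 0 < ℓ) (hab : dist a b ≤ ℓ) {n k : ℤ} (hk : n + 2 = k) :
    (simpChains (aiComplex a b ℓ) n ⧸
      (simpChains (aiComplexDot a b ℓ) n).submoduleOf (simpChains (aiComplex a b ℓ) n)) ≃ₗ[ℤ]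
      magChains a b ℓ k :=
  (Submodule.quotEquivOfEq _ _ (ker_capChains hℓ hk)).trans
    ((capChains a b ℓ hk).quotKerEquivOfSurjective (capChains_surjective hℓ hab hk))

/-- `capEquiv` as an isomorphism of the chain modules. -/
def capIso (hℓ : 0 < ℓ) (hab : dist a b ≤ ℓ) {n k : ℤ} (hk : n + 2 = k) :
    (relComplex (aiComplex a b ℓ) (aiComplexDot a b ℓ)).X n ≅ (magComplex a b ℓ).X k :=
  (capEquiv hℓ hab hk).toModuleIso

lemma capIso_comm (hℓ : 0 < ℓ) (hab : dist a b ≤ ℓ) {n n' k k' : ℤ} (hk : n + 2 = k)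
    (hk' : n' + 2 = k') (hn : n' + 1 = n) :
    (capIso hℓ hab hk).hom ≫ (magComplex a b ℓ).d k k' =
      -((relComplex (aiComplex a b ℓ) (aiComplexDot a b ℓ)).d n n' ≫ (capIso hℓ hab hk').hom) := by
  have h1 : (magComplex a b ℓ).d k k' = _ := dif_pos (show k' + 1 = k by omega)
  have h2 : (relComplex (aiComplex a b ℓ) (aiComplexDot a b ℓ)).d n n' = _ := dif_pos hn
  rw [h1, h2]
  refine ModuleCat.hom_ext (LinearMap.ext fun c => ?_)
  obtain ⟨c, rfl⟩ := Submodule.Quotient.mk_surjective _ c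
  exact Subtype.ext (capMap_boundary hℓ c.1 c.2)

/-- The negative of an isomorphism. -/
def negIso {C : Type*} [Category C] [Preadditive C] {M N : C} (e : M ≅ N) : M ≅ N where
  hom := -e.hom
  inv := -e.inv

lemma nonempty_magHomology_iso (hℓ : 0 < ℓ) (hab : dist a b ≤ ℓ) (k : ℤ) :
    Nonempty (magHomology a b ℓ k ≅
      relHomology (aiComplex a b ℓ) (aiComplexDot a b ℓ) (k - 2)) := by
  let K := relComplex (aiComplex a b ℓ) (aiComplexDot a b ℓ)
  let L := magComplex a b ℓ
  let e : K.sc' (k - 2 + 1) (k - 2) (k - 2 - 1) ≅ L.sc' (k + 1) k (k - 1) :=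
    -- The squares anticommute; in a three-term window, negating the middle isomorphism alone
    -- corrects both of them.
    ShortComplex.isoMk (capIso hℓ hab (by omega)) (negIso (capIso hℓ hab (by omega)))
      (capIso hℓ hab (by omega))
      ((capIso_comm hℓ hab _ _ rfl).trans (Preadditive.comp_neg _ _).symm)
      ((Preadditive.neg_comp _ _).trans (by
        rw [neg_eq_iff_eq_neg]
        exact capIso_comm hℓ hab _ _ (by omega)))
  exact ⟨ShortComplex.homologyMapIso
    (L.isoSc' (k + 1) k (k - 1) (ChainComplex.prev ℤ k) (ChainComplex.next ℤ k) ≪≫ e.symm ≪≫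
      (K.isoSc' (k - 2 + 1) (k - 2) (k - 2 - 1) (ChainComplex.prev ℤ _)
        (ChainComplex.next ℤ _)).symm)⟩

end MagHomology

end MagHomotopy

end

theorem mainTheorem6 {X : Type u} [MetricSpace X] (a b : X) (ℓ : ℝ) (hℓ : 0 < ℓ)
    (hab : dist a b ≤ ℓ) :
    ((MagHomotopy.essential a b ℓ).Nonempty →
      MagHomotopy.PairHomotopyEquiv (MagHomotopy.essPair a b ℓ).sub
        (MagHomotopy.aiPair a b ℓ).sus.sus.sub) ∧
    MagHomotopy.PairHomotopyEquiv
      {MagHomotopy.Collapse.base (MagHomotopy.essPair a b ℓ).sub}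
      {MagHomotopy.Collapse.base (MagHomotopy.aiPair a b ℓ).sus.sus.sub} ∧
    ∀ k : ℕ, Nonempty (MagHomotopy.magHomology a b ℓ (k : ℤ) ≅
      MagHomotopy.relHomology (MagHomotopy.aiComplex a b ℓ) (MagHomotopy.aiComplexDot a b ℓ)
        ((k : ℤ) - 2)) := by
  exact ⟨MagHomotopy.pairHomotopyEquiv_essPair hℓ hab,
    MagHomotopy.collapse_pairHomotopyEquiv hℓ hab,
    fun k => MagHomotopy.nonempty_magHomology_iso hℓ hab k⟩
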